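/- Let $\mathcal A=\prod_{p}(\mathbb Z/p\mathbb Z)\big/\bigoplus_{p}(\mathbb Z/p\mathbb Z)$, where $p$ runs over all primes. This is a $\mathbb Q$-algebra; an element is given by residues mod $p$ for all but finitely many $p$. For positive integers $s_1,\dots,s_d$ $(d\ge 1)$ define the finite multiple $T$-value of weight $s_1+\cdots+s_d$ $$T_{\mathcal A}(s_1,\dots,s_d)=\Bigg(\sum_{\substack{p>n_1>\cdots>n_d>0\\ n_j\equiv d-j+1\ (\mathrm{mod}\ 2)}}\ \prod_{j=1}^d\frac1{n_j^{s_j}}\bmod p\Bigg)_p\in\mathcal A ,$$ and for signs $\sigma_1,\dots,\sigma_d\in\{\pm1\}$ the finite Euler sum $$\zeta_{\mathcal A}(s_1,\dots,s_d;\sigma_1,\dots,\sigma_d)=\Bigg(\sum_{p>n_1>\cdots>n_d>0}\ \prod_{j=1}^d\frac{\sigma_j^{n_j}}{n_j^{s_j}}\bmod p\Bigg)_p\in\mathcal A ,$$ where instead of listing the signs one writes $\bar s_j$ for $s_j$ whenever $\sigma_j=-1$. Let $$q_2=\Big(\frac{2^{p-1}-1}{p}\bmod p\Big)_{p\ge 3},\qquad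 \beta_w=\Big(\frac{B_{p-w}}{w}\bmod p\Big)_{p>w}\quad(w\ge 2),$$ with Bernoulli numbers given by $t/(e^t-1)=\sum_{n\ge0}B_nt^n/n!$. Let $\mathsf{FMT}_w\subseteq\mathcal A$ be the $\mathbb Q$-vector space spanned by all finite multiple $T$-values of weight $w$, and write $\langle\cdots\rangle$ for the $\mathbb Q$-span. Then $$\mathsf{FMT}_1=\langle q_2\rangle,\qquad \mathsf{FMT}_2=0,\qquad \mathsf{FMT}_3=\langle\beta_3\rangle,\qquad \mathsf{FMT}_4=\langle q_2\beta_3,\ \zeta_{\mathcal A}(1,\bar3)\rangle,$$ $$\mathsf{FMT}_5=\langle\beta_5,\ \zeta_{\mathcal A}(\bar1,2,2),\ \zeta_{\mathcal A}(\bar1,\bar2,2)\rangle,\qquad \mathsf{FMT}_6=\langle\beta_3^2,\ q_2\beta_5,\ \zeta_{\mathcal A}(\bar1,2,1,2)\rangle .$$ -/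

import Mathlib

namespace FiniteMTV

instance factPrime (p : Nat.Primes) : Fact (p : ℕ).Prime := ⟨p.2⟩

/-- The direct sum `⨁ₚ ℤ/pℤ` as an ideal of `∏ₚ ℤ/pℤ`: the families that vanish at all but
finitely many primes. -/
def finitelySupported : Ideal (∀ p : Nat.Primes, ZMod p) where
  carrier := {f | {p | f p ≠ 0}.Finite}
  zero_mem' := by simp
  add_mem' := by
    intro f g hf hg
    refine (hf.union hg).subset fun p hp => ?_
    by_contra h
    simp only [Set.mem_union, Set.mem_ofPred_eq, not_or, not_not] at h
    exact hp (by simp [h.1, h.2])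
  smul_mem' := by
    intro c f hf
    refine hf.subset fun p hp h => hp ?_
    simp [h]

/-- The ring `𝒜 = ∏ₚ ℤ/pℤ / ⨁ₚ ℤ/pℤ`. -/
abbrev 𝒜 : Type := (∀ p : Nat.Primes, ZMod p) ⧸ finitelySupported

/-- The class in `𝒜` of a family of residues. -/
abbrev mk : (∀ p : Nat.Primes, ZMod p) →+* 𝒜 := Ideal.Quotient.mk finitelySupported

theorem mk_eq_mk_of_finite {f g : ∀ p : Nat.Primes, ZMod p} (h : {p | f p ≠ g p}.Finite) :
    mk f = mk g := by
  refine Ideal.Quotient.eq.2 (h.subset fun p hp hpe => hp ?_)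
  simp [hpe]

theorem finite_primes_dvd {n : ℕ} (hn : n ≠ 0) :
    {p : Nat.Primes | ((n : ℕ) : ZMod p) = 0}.Finite := by
  refine Set.Finite.of_finite_image (f := fun p : Nat.Primes => (p : ℕ)) ?_
    (Subtype.coe_injective.injOn)
  refine (Set.finite_Iic n).subset ?_
  rintro _ ⟨p, hp, rfl⟩
  exact Nat.le_of_dvd (Nat.pos_of_ne_zero hn) ((ZMod.natCast_eq_zero_iff n p).1 hp)

/-- The structure map `ℚ → 𝒜`: the rational `r = a / b` goes to the class of `(a / b mod p)ₚ`
(the components at the finitely many `p ∣ b` are irrelevant). -/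
noncomputable def ratToA : ℚ →+* 𝒜 where
  toFun r := mk fun p => (r : ZMod p)
  map_one' := by
    rw [← map_one mk]
    congr 1
    funext p
    simp
  map_zero' := by
    rw [← map_zero mk]
    congr 1
    funext p
    simp
  map_add' r s := by
    rw [← map_add mk]
    refine mk_eq_mk_of_finite
      (((finite_primes_dvd r.den_nz).union (finite_primes_dvd s.den_nz)).subset fun p hp => ?_)
    by_contra h
    simp only [Set.mem_union, Set.mem_ofPred_eq, not_or] at h
    exact hp (Rat.cast_add_of_ne_zero h.1 h.2)
  map_mul' r s := by
    rw [← map_mul mk]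
    refine mk_eq_mk_of_finite
      (((finite_primes_dvd r.den_nz).union (finite_primes_dvd s.den_nz)).subset fun p hp => ?_)
    by_contra h
    simp only [Set.mem_union, Set.mem_ofPred_eq, not_or] at h
    exact hp (Rat.cast_mul_of_ne_zero h.1 h.2)

noncomputable instance : Algebra ℚ 𝒜 := ratToA.toAlgebra

/-- `∑_{N > n₁ > ⋯ > n_d > 0} ∏ⱼ σⱼ ^ nⱼ / nⱼ ^ sⱼ` in `ℤ/pℤ`, for the list of the pairs
`(sⱼ, σⱼ)`; a pair `(s, -1)` stands for the barred entry `s̄`. -/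
noncomputable def eulerSum (p : Nat.Primes) : List (ℕ × ℤˣ) → ℕ → ZMod p
  | [], _ => 1
  | (s, σ) :: t, N =>
      ∑ n ∈ Finset.Ico 1 N, (((σ ^ n : ℤˣ) : ℤ) : ZMod p) / (n : ZMod p) ^ s * eulerSum p t n

/-- The finite Euler sum `ζ_𝒜(s₁, …, s_d; σ₁, …, σ_d)`. -/
noncomputable def eulerA (s : List (ℕ × ℤˣ)) : 𝒜 := mk fun p => eulerSum p s p

/-- `∑ ∏ⱼ 1 / nⱼ ^ sⱼ` in `ℤ/pℤ`, over `N > n₁ > ⋯ > n_d > 0` with `nⱼ ≡ d - j + 1 (mod 2)`.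
(When `sⱼ` is the head of a list, its tail has length `d - j`.) -/
noncomputable def tSum (p : Nat.Primes) : List ℕ → ℕ → ZMod p
  | [], _ => 1
  | s :: t, N =>
      ∑ n ∈ (Finset.Ico 1 N).filter (fun n => n ≡ t.length + 1 [MOD 2]),
        1 / (n : ZMod p) ^ s * tSum p t n

/-- The finite multiple `T`-value `T_𝒜(s₁, …, s_d)`. -/
noncomputable def tA (s : List ℕ) : 𝒜 := mk fun p => tSum p s p

/-- The `ℚ`-span of the finite multiple `T`-values of weight `w`. -/
noncomputable def FMT (w : ℕ) : Submodule ℚ 𝒜 :=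
  Submodule.span ℚ {x | ∃ s : List ℕ, s ≠ [] ∧ (∀ a ∈ s, 1 ≤ a) ∧ s.sum = w ∧ tA s = x}

/-- The Fermat quotient `((2 ^ (p - 1) - 1) / p mod p)_{p ≥ 3}`. -/
noncomputable def q₂ : 𝒜 := mk fun p => if 3 ≤ (p : ℕ) then (((2 ^ ((p : ℕ) - 1) - 1) / p : ℕ) : ZMod p) else 0

/-- `β_w = (B_{p - w} / w mod p)_{p > w}`; for `w ≥ 2` the denominator of `B_{p - w}` is prime
to `p`. -/
noncomputable def β (w : ℕ) : 𝒜 :=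
  mk fun p => if w < p then ((bernoulli ((p : ℕ) - w) : ℚ) : ZMod p) / (w : ZMod p) else 0

end FiniteMTV

/-!
Finite multiple `T`-values and finite Euler sums are both rational combinations of sums over
`p > n₁ > ⋯ > n_d > 0` of `∏ 1 / nⱼ ^ sⱼ` in which the parities of the `nⱼ` are prescribed.  Such a
sum is encoded by a word in three letters `z`, `e`, `o`: it is the sum of the coefficients in degree
less than `p` of a multiple polylogarithm, built by iterated integration against `dt/t`,
`t dt/(1 - t²)` and `dt/(1 - t²)`.  A `T`-value is a single word without the letter `e`.

Everything follows from three families of linear relations among words of a fixed weight.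

* In characteristic `p` the operator `t d/dt` kills the coefficient of `t ^ p`, so that in the
  coefficient of `t ^ p` of a product the letters of one factor can be moved to the other
  (`coeff_move`).  This gives the reversal relation (`wordA_dual`, the substitution `n ↦ p - n`)
  and, together with the shuffle product of polylogarithms (`coeff_wordSeries_mul`), the shuffle
  relations (`combA_shuffleRel`).
* The quasi-shuffle product of sums (`indexSum_mul`) turns three vanishing combinations of weight two
  (`wordA_ze`, `wordA_oo`, `wordA_oe`) into relations of every higher weight.  Only the first of
  these needs an input from outside: `∑ 1 / n ^ 2 = 0` in `ℤ/pℤ` for `p > 3`.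

In weight `w ≤ 6` these relations leave a quotient in which the `T`-values and the proposed
generators span the same subspace.  This is a statement of linear algebra with integer coefficients;
it is decided by a sparse elimination (`insertRow`, `reducesToZero`) whose soundness is proved for an
arbitrary submodule containing the values of all rows (`rowEval_mem_of_reducesToZero`), and
`FMT_eq_of_spanned` draws the conclusion in `𝒜`.

Finally the sums of depth one are identified: `q₂` is the word `o` by the binomial expansion of
`2 ^ p` (`q₂_eq_wordA`), and `β w` for `w = 3, 5` is a nonzero rational multiple of `z ^ (w - 1) o` by
Faulhaber's formula at `1/2` (`wordA_replicate_o`).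
-/

namespace FiniteMTV

/-! ### Integral linear algebra on sparse rows -/

/-- A sparse vector with integer coefficients: pairs (coordinate, coefficient), the coordinates
strictly increasing.  No statement below depends on the coordinates being sorted; sortedness only
makes the elimination effective. -/
abbrev Row := List (ℕ × ℤ)

/-- Add `c` times the `k`-th basis vector to a row. -/
def addTerm (k : ℕ) (c : ℤ) : Row → Row
  | [] => [(k, c)]
  | (k', c') :: r =>
    match Nat.ble k k' with
    | false => (k', c') :: addTerm k c r
    | true => match Nat.ble k' k with
      | false => (k, c) :: (k', c') :: r
      | true => match c + c' with
        | Int.ofNat 0 => r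
        | d => (k, d) :: r

/-- Multiply a row by an integer. -/
def scaleRow (b : ℤ) : Row → Row
  | [] => []
  | (k, c) :: r => (k, b * c) :: scaleRow b r

/-- Merge the term `(k, c)` and the rest of a row, represented by the function `F` that merges it
into any other row, with `b` times the given row. -/
def mergeAux (k : ℕ) (c b : ℤ) (F : Row → Row) : Row → Row
  | [] => (k, c) :: F []
  | (k', c') :: r =>
    match Nat.ble k k' with
    | false => (k', b * c') :: mergeAux k c b F r
    | true => match Nat.ble k' k with
      | false => (k, c) :: F ((k', c') :: r)
      | true => match c + b * c' with
        | Int.ofNat 0 => F r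
        | d => (k, d) :: F r

/-- The row `a • s + b • r`. -/
def linComb (a b : ℤ) : Row → Row → Row
  | [], r => scaleRow b r
  | (k, c) :: s, r => mergeAux k (a * c) b (linComb a b s) r

/-- For rows with the same first coordinate, first coefficients `c`, `d` and tails `s`, `r`: the
primitive combination of the two in which the first coordinate cancels. -/
def elim (c d : ℤ) (s r : Row) : Row :=
  linComb (d / (Int.gcd c d : ℕ)) (-(c / (Int.gcd c d : ℕ))) s r

/-- The greatest common divisor of the coefficients of a row. -/
def content : Row → ℕ
  | [] => 0
  | (_, c) :: r => Nat.gcd c.natAbs (content r)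

/-- Divide every coefficient of a row by `n`. -/
def divRow (n : ℤ) : Row → Row
  | [] => []
  | (k, c) :: r => (k, c / n) :: divRow n r

/-- Insert a row into a list of rows in echelon form. -/
def insertRow (s : Row) : List Row → List Row
  | [] => match s with
    | [] => []
    | _ => [divRow (content s) s]
  | r :: B => match s, r with
    | [], _ => r :: B
    | _, [] => B
    | (k, c) :: s', (k', c') :: r' =>
      match Nat.ble k k' with
      | false => r :: insertRow s B
      | true => match Nat.ble k' k with
        | false => divRow (content s) s :: r :: B
        | true => r :: insertRow (elim c c' s' r') B

/-- Whether a row reduces to zero modulo a list of rows in echelon form. -/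
def reducesToZero (s : Row) : List Row → Bool
  | [] => s.isEmpty
  | r :: B => match s, r with
    | [], _ => true
    | _, [] => false
    | (k, c) :: s', (k', c') :: r' =>
      match Nat.ble k k' with
      | false => reducesToZero s B
      | true => match Nat.ble k' k with
        | false => false
        | true => match c' / (Int.gcd c c' : ℕ) with
          | Int.ofNat 0 => false
          | _ => reducesToZero (elim c c' s' r') B

section Eval

variable {V : Type*} [AddCommGroup V] [Module ℚ V] (φ : ℕ → V)

/-- The value of a row when the `k`-th basis vector is sent to `φ k`. -/
def rowEval : Row → V
  | [] => 0
  | (k, c) :: r => (c : ℚ) • φ k + rowEval r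

theorem rowEval_addTerm (k : ℕ) (c : ℤ) (r : Row) :
    rowEval φ (addTerm k c r) = (c : ℚ) • φ k + rowEval φ r := by
  induction r with
  | nil => simp [addTerm, rowEval]
  | cons x r ih =>
    obtain ⟨k', c'⟩ := x
    rw [addTerm]
    split
    · simp only [rowEval, ih]; abel
    · rename_i h
      split
      · simp only [rowEval]
      · rename_i h'
        obtain rfl : k = k' := le_antisymm (Nat.le_of_ble_eq_true h) (Nat.le_of_ble_eq_true h')
        have key : ((c + c' : ℤ) : ℚ) • φ k + rowEval φ r
            = (c : ℚ) • φ k + ((c' : ℚ) • φ k + rowEval φ r) := by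
          push_cast; rw [add_smul, add_assoc]
        split
        · rename_i h0
          rw [rowEval, ← key, h0]; simp
        · rw [rowEval, rowEval, key]

theorem rowEval_scaleRow (b : ℤ) (r : Row) :
    rowEval φ (scaleRow b r) = (b : ℚ) • rowEval φ r := by
  induction r with
  | nil => simp [scaleRow, rowEval]
  | cons x r ih => simp [scaleRow, rowEval, ih, mul_smul]

theorem rowEval_mergeAux (k : ℕ) (c b : ℤ) (F : Row → Row) (v : V)
    (hF : ∀ r, rowEval φ (F r) = v + (b : ℚ) • rowEval φ r) (r : Row) :
    rowEval φ (mergeAux k c b F r) = (c : ℚ) • φ k + v + (b : ℚ) • rowEval φ r := by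
  induction r with
  | nil => simp [mergeAux, rowEval, hF]
  | cons x r ih =>
    obtain ⟨k', c'⟩ := x
    rw [mergeAux]
    split
    · simp only [rowEval, ih, smul_add, Int.cast_mul, mul_smul]; abel
    · rename_i h
      split
      · simp only [rowEval, hF]; abel
      · rename_i h'
        obtain rfl : k = k' := le_antisymm (Nat.le_of_ble_eq_true h) (Nat.le_of_ble_eq_true h')
        have key : ((c + b * c' : ℤ) : ℚ) • φ k + (v + (b : ℚ) • rowEval φ r)
            = (c : ℚ) • φ k + v + (b : ℚ) • ((c' : ℚ) • φ k + rowEval φ r) := by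
          push_cast; rw [add_smul, smul_add, mul_smul]; abel
        split
        · rename_i h0
          rw [hF, rowEval, ← key, h0]; simp
        · rw [rowEval, rowEval, hF, key]

theorem rowEval_linComb (a b : ℤ) (s r : Row) :
    rowEval φ (linComb a b s r) = (a : ℚ) • rowEval φ s + (b : ℚ) • rowEval φ r := by
  induction s generalizing r with
  | nil => simp [linComb, rowEval, rowEval_scaleRow]
  | cons x s ih =>
    rw [linComb, rowEval_mergeAux φ _ _ _ _ _ (fun r => ih r), rowEval]
    simp [mul_smul]

/-- The first coordinates cancel because `c * (d / gcd c d) = d * (c / gcd c d)`. -/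
theorem rowEval_elim (k : ℕ) (c d : ℤ) (s r : Row) :
    rowEval φ (elim c d s r)
      = ((d / (Int.gcd c d : ℕ) : ℤ) : ℚ) • rowEval φ ((k, c) :: s)
        - ((c / (Int.gcd c d : ℕ) : ℤ) : ℚ) • rowEval φ ((k, d) :: r) := by
  have h : d / (Int.gcd c d : ℕ) * c = c / (Int.gcd c d : ℕ) * d := by
    obtain ⟨c', hc⟩ := Int.gcd_dvd_left c d
    obtain ⟨d', hd⟩ := Int.gcd_dvd_right c d
    generalize hg : ((Int.gcd c d : ℕ) : ℤ) = g at hc hd ⊢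
    subst hc; subst hd
    rcases eq_or_ne g 0 with rfl | h0
    · simp
    · rw [Int.mul_ediv_cancel_left _ h0, Int.mul_ediv_cancel_left _ h0]; ring
  have h' : ((d / (Int.gcd c d : ℕ) : ℤ) : ℚ) * c = ((c / (Int.gcd c d : ℕ) : ℤ) : ℚ) * d := by
    exact_mod_cast h
  rw [elim, rowEval_linComb, rowEval, rowEval, smul_add, smul_add, ← mul_smul, ← mul_smul, h']
  push_cast
  rw [neg_smul]; abel

theorem content_dvd (r : Row) : ∀ x ∈ r, (content r : ℤ) ∣ x.2 := by
  induction r with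
  | nil => simp
  | cons y r ih =>
    intro x hx
    rcases List.mem_cons.1 hx with rfl | hx
    · exact Int.natCast_dvd.2 (Nat.gcd_dvd_left _ _)
    · exact (Int.natCast_dvd_natCast.2 (Nat.gcd_dvd_right _ _)).trans (ih x hx)

theorem rowEval_divRow (n : ℤ) (r : Row) (h : ∀ x ∈ r, n ∣ x.2) :
    (n : ℚ) • rowEval φ (divRow n r) = rowEval φ r := by
  induction r with
  | nil => simp [divRow, rowEval]
  | cons x r ih =>
    obtain ⟨k, c⟩ := x
    have hc : n * (c / n) = c := Int.mul_ediv_cancel' (h (k, c) (by simp))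
    rw [divRow, rowEval, rowEval, smul_add, ih fun x hx => h x (by simp [hx]), ← mul_smul]
    congr 2
    exact_mod_cast hc

variable (M : Submodule ℚ V)

theorem rowEval_divRow_content_mem {s : Row} (hs : rowEval φ s ∈ M) :
    rowEval φ (divRow (content s) s) ∈ M := by
  have h := rowEval_divRow φ (content s) s (content_dvd s)
  rcases Nat.eq_zero_or_pos (content s) with h0 | h0
  -- A row of content zero has only zero coefficients.
  · have hz : ∀ r : Row, (∀ x ∈ r, x.2 = 0) → rowEval φ (divRow 0 r) = 0 := by
      intro r hr
      induction r with
      | nil => rfl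
      | cons x r ih => simp [divRow, rowEval, ih fun y hy => hr y (by simp [hy])]
    rw [h0, Nat.cast_zero, hz]
    · exact M.zero_mem
    · intro x hx
      simpa [h0] using content_dvd s x hx
  · have hne : ((content s : ℤ) : ℚ) ≠ 0 := by exact_mod_cast h0.ne'
    rw [← h] at hs
    exact (M.smul_mem_iff hne).1 hs

/-- Insertion keeps the values of all rows in a submodule. -/
theorem insertRow_mem {B : List Row} {s : Row} (hB : ∀ r ∈ B, rowEval φ r ∈ M)
    (hs : rowEval φ s ∈ M) : ∀ r ∈ insertRow s B, rowEval φ r ∈ M := by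
  induction B generalizing s with
  | nil =>
    rcases s with _ | ⟨x, s⟩
    · simp [insertRow]
    · simpa [insertRow] using rowEval_divRow_content_mem φ M hs
  | cons r B ih =>
    have hr := hB r (by simp)
    have hB' : ∀ r ∈ B, rowEval φ r ∈ M := fun x hx => hB x (by simp [hx])
    rcases s with _ | ⟨⟨k, c⟩, s'⟩
    · simpa [insertRow] using hB
    rcases r with _ | ⟨⟨k', c'⟩, r'⟩
    · simpa [insertRow] using hB'
    · rw [insertRow]
      split
      · exact List.forall_mem_cons.2 ⟨hr, ih hB' hs⟩
      · rename_i h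
        split
        · exact List.forall_mem_cons.2 ⟨rowEval_divRow_content_mem φ M hs, hB⟩
        · rename_i h'
          obtain rfl : k = k' :=
            le_antisymm (Nat.le_of_ble_eq_true h) (Nat.le_of_ble_eq_true h')
          refine List.forall_mem_cons.2 ⟨hr, ih hB' ?_⟩
          rw [rowEval_elim φ k]
          exact M.sub_mem (M.smul_mem _ hs) (M.smul_mem _ hr)

theorem foldl_insertRow_mem {l B : List Row} (hB : ∀ r ∈ B, rowEval φ r ∈ M)
    (hl : ∀ r ∈ l, rowEval φ r ∈ M) :
    ∀ r ∈ l.foldl (fun B s => insertRow s B) B, rowEval φ r ∈ M := by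
  induction l generalizing B with
  | nil => exact hB
  | cons s l ih =>
    exact ih (insertRow_mem φ M hB (hl s (by simp))) fun r hr => hl r (by simp [hr])

/-- Soundness of the elimination: each step replaces a row by a nonzero multiple of it minus a
multiple of a row of the list, so if the end result is zero, the row has its value in every submodule
that contains the values of the list. -/
theorem rowEval_mem_of_reducesToZero {B : List Row} {s : Row}
    (hB : ∀ r ∈ B, rowEval φ r ∈ M) (h : reducesToZero s B = true) : rowEval φ s ∈ M := by
  induction B generalizing s with
  | nil =>
    rw [reducesToZero, List.isEmpty_iff] at h
    subst h
    exact M.zero_mem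
  | cons r B ih =>
    have hr := hB r (by simp)
    have hB' : ∀ r ∈ B, rowEval φ r ∈ M := fun x hx => hB x (by simp [hx])
    rcases s with _ | ⟨⟨k, c⟩, s'⟩
    · exact M.zero_mem
    rcases r with _ | ⟨⟨k', c'⟩, r'⟩
    · simp [reducesToZero] at h
    · rw [reducesToZero] at h
      split at h
      · exact ih hB' h
      · rename_i hk
        split at h
        · simp at h
        · rename_i hk'
          obtain rfl : k = k' :=
            le_antisymm (Nat.le_of_ble_eq_true hk) (Nat.le_of_ble_eq_true hk')
          split at h
          · simp at h
          · rename_i h0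
            have h1 := ih hB' h
            rw [rowEval_elim φ k, M.sub_mem_iff_left (M.smul_mem _ hr)] at h1
            refine (M.smul_mem_iff ?_).1 h1
            exact_mod_cast h0

end Eval

/-! ### Words and their power series -/

/-- The letters of the iterated integrals that generate the sums over `n₁ > ⋯ > n_d > 0` with
prescribed parities: `z` for `dt/t`, `e` for `t dt/(1 - t²)` and `o` for `dt/(1 - t²)`. -/
inductive Letter | e | z | o

open Letter

/-- Words in the letters; `z ^ (s₁ - 1) a₁ ⋯ z ^ (s_d - 1) a_d` stands for the sum with exponents
`s₁, …, s_d` in which `nⱼ - nⱼ₊₁` is even for `aⱼ = e` and odd for `aⱼ = o` (`n_{d+1} = 0`). -/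
abbrev Word := List Letter

/-- The letter for an odd (`true`) or even (`false`) difference. -/
def step (b : Bool) : Letter := match b with | true => o | false => e

/-- Whether the number of letters `o` is odd; this is the parity of the outermost index `n₁`. -/
def oddWord : Word → Bool
  | [] => false
  | o :: t => !oddWord t
  | _ :: t => oddWord t

@[simp] theorem oddWord_step_cons (b : Bool) (w : Word) :
    oddWord (step b :: w) = (b ^^ oddWord w) := by
  cases b <;> simp [step, oddWord]

theorem oddWord_cons (a : Letter) (w : Word) : oddWord (a :: w) = (oddWord [a] ^^ oddWord w) := by
  cases a <;> simp [oddWord]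

theorem oddWord_append (u v : Word) : oddWord (u ++ v) = (oddWord u ^^ oddWord v) := by
  induction u with
  | nil => simp [oddWord]
  | cons a u ih => rw [List.cons_append, oddWord_cons, ih, oddWord_cons a u, Bool.xor_assoc]

theorem oddWord_reverse (u : Word) : oddWord u.reverse = oddWord u := by
  induction u with
  | nil => rfl
  | cons a u ih => rw [List.reverse_cons, oddWord_append, ih, oddWord_cons a u, Bool.xor_comm]

theorem oddWord_replicate_z (k : ℕ) : oddWord (List.replicate k z) = false := by
  induction k with
  | zero => rfl
  | succ k ih => rw [List.replicate_succ, oddWord, ih]; simp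

open PowerSeries

section Series

variable (K : Type*) [Field K]

/-- The power series of a letter: `1`, `t² + t⁴ + ⋯` and `t + t³ + ⋯`. -/
noncomputable def letterSeries : Letter → K⟦X⟧
  | e => PowerSeries.mk fun n => if n ≠ 0 ∧ n.bodd = false then 1 else 0
  | z => 1
  | o => PowerSeries.mk fun n => if n.bodd = true then 1 else 0

variable {K}

/-- The operator `f ↦ ∫ f dt/t`, with the junk value `0` in the degrees that vanish in `K`. -/
noncomputable def logIntegral (f : K⟦X⟧) : K⟦X⟧ := PowerSeries.mk fun n => coeff n f / n

variable (K)

/-- The multiple polylogarithm of a word. -/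
noncomputable def wordSeries : Word → K⟦X⟧
  | [] => 1
  | a :: u => logIntegral (letterSeries K a * wordSeries u)

variable {K}

@[simp] theorem coeff_logIntegral (n : ℕ) (f : K⟦X⟧) :
    coeff n (logIntegral f) = coeff n f / n := by simp [logIntegral]

theorem coeff_letterSeries_step (b : Bool) (n : ℕ) :
    coeff n (letterSeries K (step b)) = if n ≠ 0 ∧ n.bodd = b then 1 else 0 := by
  cases b
  · simp [step, letterSeries]
  · by_cases h : n = 0 <;> simp [step, letterSeries, h]

theorem coeff_zero_wordSeries_cons (a : Letter) (u : Word) :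
    coeff 0 (wordSeries K (a :: u)) = 0 := by
  rw [wordSeries, coeff_logIntegral]; simp

/-- The series of a word is concentrated in the degrees of one parity. -/
theorem coeff_wordSeries_eq_zero (w : Word) (n : ℕ) (h : n.bodd ≠ oddWord w) :
    coeff n (wordSeries K w) = 0 := by
  induction w generalizing n with
  | nil =>
    rw [wordSeries, coeff_one, if_neg]
    rintro rfl
    exact h rfl
  | cons a u ih =>
    rw [wordSeries, coeff_logIntegral, coeff_mul, Finset.sum_eq_zero, zero_div]
    rintro ⟨i, j⟩ hij
    obtain rfl := Finset.HasAntidiagonal.mem_antidiagonal.1 hij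
    rw [oddWord_cons, Nat.bodd_add] at h
    by_cases hj : j.bodd = oddWord u
    · have hi : i.bodd ≠ oddWord [a] := fun hi => h (by rw [hi, hj])
      have : coeff i (letterSeries K a) = 0 := by
        cases a
        · have : i.bodd = true := by simpa [oddWord] using hi
          simp [letterSeries, this]
        · rw [letterSeries, coeff_one, if_neg]
          rintro rfl
          exact hi rfl
        · simpa [letterSeries, oddWord] using hi
      simp [this]
    · simp [ih j hj]

/-- Multiplication by the series of `e` or `o` sums the coefficients of lower degree, in the degrees
of the right parity. -/
theorem coeff_step_mul_wordSeries (b : Bool) (w : Word) (n : ℕ) :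
    coeff n (letterSeries K (step b) * wordSeries K w)
      = if n.bodd = (b ^^ oddWord w) then ∑ m ∈ Finset.range n, coeff m (wordSeries K w)
        else 0 := by
  rw [mul_comm, coeff_mul, Finset.Nat.sum_antidiagonal_eq_sum_range_succ_mk,
    Finset.sum_range_succ]
  have h0 : coeff (n - n) (letterSeries K (step b)) = 0 := by
    simp [coeff_letterSeries_step]
  rw [h0, mul_zero, add_zero]
  split_ifs with h
  · refine Finset.sum_congr rfl fun m hm => ?_
    have hm := Finset.mem_range.1 hm
    by_cases hw : m.bodd = oddWord w
    · have : (n - m).bodd = b := by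
        have h1 := Nat.bodd_add (n - m) m
        rw [Nat.sub_add_cancel hm.le, h, hw] at h1
        simpa using h1.symm
      rw [coeff_letterSeries_step, if_pos ⟨by omega, this⟩, mul_one]
    · simp [coeff_wordSeries_eq_zero w m hw]
  · refine Finset.sum_eq_zero fun m hm => ?_
    have hm := Finset.mem_range.1 hm
    by_cases hw : m.bodd = oddWord w
    · have : (n - m).bodd ≠ b := by
        rintro rfl
        have h1 := Nat.bodd_add (n - m) m
        rw [Nat.sub_add_cancel hm.le, hw] at h1
        exact h h1
      rw [coeff_letterSeries_step, if_neg fun h => this h.2, mul_zero]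
    · simp [coeff_wordSeries_eq_zero w m hw]

/-! ### Shuffle product -/

/-- The shuffles of `a :: u` with a word, given the function `F` that shuffles `u` with it. -/
def shuffleAux (a : Letter) (u : Word) (F : Word → List Word) : Word → List Word
  | [] => [a :: u]
  | b :: v => (F (b :: v)).map (a :: ·) ++ (shuffleAux a u F v).map (b :: ·)

/-- The list of all shuffles of two words. -/
def shuffle : Word → Word → List Word
  | [], v => [v]
  | a :: u, v => shuffleAux a u (shuffle u) v

theorem shuffle_cons_cons (a b : Letter) (u v : Word) :
    shuffle (a :: u) (b :: v)
      = (shuffle u (b :: v)).map (a :: ·) ++ (shuffle (a :: u) v).map (b :: ·) := rfl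

theorem shuffle_nil_right (u : Word) : shuffle u [] = [u] := by cases u <;> rfl

theorem oddWord_of_mem_shuffle {u v x : Word} (h : x ∈ shuffle u v) :
    oddWord x = (oddWord u ^^ oddWord v) := by
  induction u generalizing v x with
  | nil => simp_all [shuffle, oddWord]
  | cons a u ihu =>
    induction v generalizing x with
    | nil => simp_all [shuffle_nil_right, oddWord]
    | cons b v ihv =>
      rw [shuffle_cons_cons, List.mem_append, List.mem_map, List.mem_map] at h
      rcases h with ⟨y, hy, rfl⟩ | ⟨y, hy, rfl⟩
      · rw [oddWord_cons, ihu hy, oddWord_cons a u, Bool.xor_assoc]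
      · rw [oddWord_cons, ihv hy, oddWord_cons b v, ← Bool.xor_assoc, ← Bool.xor_assoc,
          Bool.xor_comm (oddWord [b])]

/-- A word that does not end in `z`.  For other words `wordSeries` involves the junk value of
`logIntegral` on a constant, and the shuffle product formula fails. -/
def Admissible : Word → Prop
  | [] => True
  | a :: u => (u = [] → a ≠ z) ∧ Admissible u

theorem coeff_zero_letterSeries_mul {a : Letter} {u : Word} (h : Admissible (a :: u)) :
    coeff 0 (letterSeries K a * wordSeries K u) = 0 := by
  rcases u with _ | ⟨b, u⟩
  · have := h.1 rfl
    cases a <;> simp_all [letterSeries, wordSeries]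
  · have := coeff_zero_wordSeries_cons (K := K) b u
    rw [coeff_zero_eq_constantCoeff] at this
    simp [this]

theorem coeff_mul_congr {f g : K⟦X⟧} {n : ℕ} (h : ∀ j ≤ n, coeff j f = coeff j g)
    (F : K⟦X⟧) : coeff n (F * f) = coeff n (F * g) := by
  rw [coeff_mul, coeff_mul]
  refine Finset.sum_congr rfl fun ij hij => ?_
  have := Finset.HasAntidiagonal.mem_antidiagonal.1 hij
  rw [h _ (by omega)]

theorem sum_wordSeries_map_cons (a : Letter) (l : List Word) :
    ((l.map (a :: ·)).map (wordSeries K)).sum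
      = logIntegral (letterSeries K a * (l.map (wordSeries K)).sum) := by
  induction l with
  | nil => ext n; simp
  | cons x l ih =>
    ext n
    rw [List.map_cons, List.map_cons, List.sum_cons, ih, List.map_cons, List.sum_cons, mul_add]
    simp [wordSeries, add_div]

/-- The shuffle product formula, in the degrees up to which one can divide. -/
theorem coeff_wordSeries_mul {N : ℕ} (hN : ∀ n, 0 < n → n < N → (n : K) ≠ 0) {u v : Word}
    (hu : Admissible u) (hv : Admissible v) {n : ℕ} (hn : n < N) :
    coeff n (wordSeries K u * wordSeries K v)
      = coeff n ((shuffle u v).map (wordSeries K)).sum := by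
  induction u generalizing v n with
  | nil => simp [shuffle, wordSeries]
  | cons a u ihu =>
    induction v generalizing n with
    | nil => simp [shuffle_nil_right, wordSeries]
    | cons b v ihv =>
      rw [shuffle_cons_cons, List.map_append, List.sum_append, sum_wordSeries_map_cons,
        sum_wordSeries_map_cons, map_add, coeff_logIntegral, coeff_logIntegral]
      rcases Nat.eq_zero_or_pos n with rfl | h0
      · have := coeff_zero_wordSeries_cons (K := K) a u
        simp only [coeff_zero_eq_constantCoeff] at this
        simp [this]
      rw [← add_div, eq_div_iff (hN n h0 hn),
        ← coeff_mul_congr (fun j hj => ihu hu.2 hv (hj.trans_lt hn)) (letterSeries K a),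
        ← coeff_mul_congr (fun j hj => ihv hv.2 (hj.trans_lt hn)) (letterSeries K b),
        ← mul_assoc, mul_left_comm, coeff_mul, coeff_mul, coeff_mul, Finset.sum_mul,
        ← Finset.sum_add_distrib]
      refine Finset.sum_congr rfl ?_
      rintro ⟨i, j⟩ hij
      obtain rfl := Finset.HasAntidiagonal.mem_antidiagonal.1 hij
      -- Integration by parts: `t d/dt` undoes `logIntegral` in the degrees considered.
      have key : ∀ {c : Letter} {w : Word} {m : ℕ}, Admissible (c :: w) → m < N →
          coeff m (letterSeries K c * wordSeries K w) = coeff m (wordSeries K (c :: w)) * m := by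
        intro c w m hcw hm
        rw [wordSeries, coeff_logIntegral]
        rcases Nat.eq_zero_or_pos m with rfl | hm0
        · rw [coeff_zero_letterSeries_mul hcw]; simp
        · rw [div_mul_cancel₀ _ (hN m hm0 hm)]
      simp only
      rw [key hu (by omega), key hv (by omega)]
      push_cast
      ring

/-! ### Pairing and reversal -/

/-- The operator `logIntegral` is skew-adjoint for the pairing of two series given by the
coefficient of `t ^ p` of their product. -/
theorem coeff_logIntegral_mul {p : ℕ} (hp : (p : K) = 0) (f g : K⟦X⟧) :
    coeff p (logIntegral f * g) = -coeff p (f * logIntegral g) := by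
  rw [coeff_mul, coeff_mul, ← Finset.sum_neg_distrib]
  refine Finset.sum_congr rfl ?_
  rintro ⟨i, j⟩ hij
  have hj : (j : K) = -i := by
    rw [eq_neg_iff_add_eq_zero, add_comm, ← Nat.cast_add,
      Finset.HasAntidiagonal.mem_antidiagonal.1 hij, hp]
  rw [coeff_logIntegral, coeff_logIntegral, hj, div_neg]
  ring

/-- Repeated integration by parts: in the coefficient of `t ^ p` of a product, the letters of one
factor may be moved one by one to the other. -/
theorem coeff_move {p : ℕ} (hp : (p : K) = 0) (x : Word) (c d : Letter) (y v : Word) :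
    coeff p (letterSeries K c * wordSeries K y * wordSeries K (x ++ d :: v))
      = (-1) ^ (x.length + 1) *
        coeff p (letterSeries K d * wordSeries K (x.reverse ++ c :: y) * wordSeries K v) := by
  induction x generalizing c y with
  | nil =>
    rw [List.nil_append, wordSeries, mul_comm, coeff_logIntegral_mul hp, List.reverse_nil,
      List.nil_append, wordSeries, mul_right_comm]
    simp
  | cons a x ih =>
    have h := ih a (c :: y)
    rw [List.cons_append, wordSeries, mul_comm, coeff_logIntegral_mul hp, mul_right_comm]
    rw [wordSeries] at h
    rw [h, List.reverse_cons, List.append_assoc, List.singleton_append, List.length_cons]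
    ring

end Series

open Letter PowerSeries

/-! ### Truncated sums of words and their linear relations -/

/-- The sum over `p > n₁ > ⋯ > n_d > 0` encoded by a word, in `ℤ/pℤ`. -/
noncomputable def wordSum (p : Nat.Primes) (w : Word) : ZMod p :=
  ∑ n ∈ Finset.range p, coeff n (wordSeries (ZMod p) w)

/-- The class in `𝒜` of the truncated sums of a word. -/
noncomputable def wordA (w : Word) : 𝒜 := mk fun p => wordSum p w

theorem natCast_ne_zero_of_lt {p : Nat.Primes} {n : ℕ} (h0 : 0 < n) (h : n < p) :
    (n : ZMod p) ≠ 0 := by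
  rw [Ne, ZMod.natCast_eq_zero_iff]
  exact Nat.not_dvd_of_pos_of_lt h0 h

theorem bodd_of_odd_prime {p : Nat.Primes} (hp : (p : ℕ) ≠ 2) : (p : ℕ).bodd = true := by
  have h := Nat.mod_two_of_bodd p
  rw [p.2.eq_two_or_odd.resolve_left hp] at h
  cases hb : (p : ℕ).bodd
  · simp [hb] at h
  · rfl

theorem coeff_prime_step_mul {p : Nat.Primes} (hp : (p : ℕ) ≠ 2) {b : Bool} {w : Word}
    (h : oddWord (step b :: w) = true) :
    coeff p (letterSeries (ZMod p) (step b) * wordSeries (ZMod p) w) = wordSum p w := by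
  rw [coeff_step_mul_wordSeries, if_pos, wordSum]
  rw [bodd_of_odd_prime hp, ← oddWord_step_cons, h]

/-- The word of the sum obtained by the substitution `nⱼ ↦ p - n_{d+1-j}`, for an odd prime `p`: the
differences of consecutive indices are the same in reversed order, and only the parity of the last
index has to be adjusted.  A word that ends in `z` is left unchanged. -/
def dual (w : Word) : Word :=
  match w.reverse with
  | [] => []
  | z :: _ => w
  | _ :: x => x ++ [step !oddWord w]

theorem dual_append_step (x : Word) (b : Bool) :
    dual (x ++ [step b]) = x.reverse ++ [step !oddWord (x ++ [step b])] := by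
  rw [dual, List.reverse_append]
  cases b <;> rfl

/-- Moving all letters of the word `x ++ [step b]` in the coefficient of `t ^ p` reverses it. -/
theorem wordSum_dual {p : Nat.Primes} (hp : (p : ℕ) ≠ 2) (x : Word) (b : Bool) :
    wordSum p (x ++ [step b])
      = (-1) ^ (x.length + 1) * wordSum p (dual (x ++ [step b])) := by
  have h := coeff_move (K := ZMod p) (p := p) (by simp) x
    (step !oddWord (x ++ [step b])) (step b) [] []
  simp only [wordSeries, mul_one] at h
  rw [coeff_prime_step_mul hp (by simp), coeff_prime_step_mul hp] at h
  · rw [h, dual_append_step]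
  · rw [oddWord_step_cons, oddWord_append, oddWord_append, oddWord_reverse, oddWord_step_cons,
      oddWord_step_cons]
    cases b <;> cases oddWord x <;> simp [oddWord]

theorem eq_dual_or (w : Word) : dual w = w ∨ ∃ x b, w = x ++ [step b] := by
  rcases List.eq_nil_or_concat w with rfl | ⟨x, a, rfl⟩
  · exact Or.inl rfl
  · cases a
    · exact Or.inr ⟨x, false, by simp [step]⟩
    · left; simp [dual]
    · exact Or.inr ⟨x, true, by simp [step]⟩

theorem mk_eq_mk_of_ne_two {f g : ∀ p : Nat.Primes, ZMod p}
    (h : ∀ p : Nat.Primes, (p : ℕ) ≠ 2 → f p = g p) : mk f = mk g := by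
  refine mk_eq_mk_of_finite ((Set.finite_singleton (⟨2, Nat.prime_two⟩ : Nat.Primes)).subset ?_)
  intro p hp
  by_contra h2
  exact hp (h p fun hp2 => h2 (Subtype.ext hp2))

theorem wordA_dual {w : Word} (hw : dual w ≠ w) :
    wordA w = (-1) ^ w.length * wordA (dual w) := by
  obtain ⟨x, b, rfl⟩ := (eq_dual_or w).resolve_left hw
  have : ((-1) ^ (x ++ [step b]).length * wordA (dual (x ++ [step b])) : 𝒜)
      = mk fun p => (-1) ^ (x.length + 1) * wordSum p (dual (x ++ [step b])) := by
    rw [wordA, List.length_append, List.length_singleton,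
      show (-1 : 𝒜) = mk (fun _ => -1) from (map_neg mk 1).trans (by rw [map_one]) |>.symm,
      ← map_pow, ← map_mul]
    rfl
  rw [this]
  exact mk_eq_mk_of_ne_two fun p hp => wordSum_dual hp x b

/-- A formal integral combination of words. -/
abbrev Comb := List (Word × ℤ)

/-- The value in `𝒜` of a formal combination of words. -/
noncomputable def combA : Comb → 𝒜
  | [] => 0
  | (w, c) :: l => (c : 𝒜) * wordA w + combA l

theorem combA_append (l l' : Comb) : combA (l ++ l') = combA l + combA l' := by
  induction l with
  | nil => simp [combA]
  | cons x l ih => simp [combA, ih, add_assoc]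

theorem intCast_mul_mk (c : ℤ) (f : ∀ p : Nat.Primes, ZMod p) :
    (c : 𝒜) * mk f = mk fun p => (c : ZMod p) * f p := by
  rw [← map_intCast mk, ← map_mul]
  rfl

theorem combA_map {α : Type*} (l : List α) (g : α → Word) (c : ℤ) :
    combA (l.map fun x => (g x, c))
      = mk fun p => (c : ZMod p) * (l.map fun x => wordSum p (g x)).sum := by
  induction l with
  | nil =>
    rw [List.map_nil, combA, ← map_zero mk]
    congr 1
    funext p
    simp
  | cons x l ih =>
    rw [List.map_cons, combA, ih, wordA, intCast_mul_mk, ← map_add]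
    congr 1
    funext p
    simp [mul_add]

/-- The shuffle relation for the words `z ^ k a` and `v`, where `a = step b`. -/
def shuffleRel (k : ℕ) (b : Bool) (v : Word) : Comb :=
  (List.replicate k z ++ step (!oddWord (step b :: v)) :: v, 1) ::
    (shuffle (List.replicate k z ++ [step b]) v).map fun x => (x, (-1) ^ k)

theorem admissible_replicate_append (k : ℕ) (b : Bool) {v : Word} (hv : Admissible v) :
    Admissible (List.replicate k z ++ step b :: v) := by
  induction k with
  | zero => exact ⟨fun _ => by cases b <;> simp [step], hv⟩
  | succ k ih => exact ⟨by simp, ih⟩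

theorem coeff_mul_sum_wordSeries {p : Nat.Primes} (hp : (p : ℕ) ≠ 2) (b : Bool) (l : List Word)
    (h : ∀ x ∈ l, oddWord (step b :: x) = true) :
    coeff p (letterSeries (ZMod p) (step b) * (l.map (wordSeries (ZMod p))).sum)
      = (l.map (wordSum p)).sum := by
  induction l with
  | nil => simp
  | cons x l ih =>
    rw [List.map_cons, List.sum_cons, mul_add, map_add, ih fun y hy => h y (by simp [hy]),
      coeff_prime_step_mul hp (h x (by simp)), List.map_cons, List.sum_cons]

/-- The first sum is the coefficient of `t ^ p` of the product of the series of `step b` and of the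
word.  Moving the letters of `z ^ k` and one further letter to the first factor gives the coefficient
of a product of the polylogarithms of `z ^ k (step b)` and `v`. -/
theorem wordSum_shuffle {p : Nat.Primes} (hp : (p : ℕ) ≠ 2) (k : ℕ) (b : Bool) {v : Word}
    (hv : Admissible v) :
    wordSum p (List.replicate k z ++ step (!oddWord (step b :: v)) :: v)
      + (-1) ^ k * ((shuffle (List.replicate k z ++ [step b]) v).map (wordSum p)).sum = 0 := by
  set d := !oddWord (step b :: v) with hd
  have hdb : (d ^^ (b ^^ oddWord v)) = true := by
    rw [hd, oddWord_step_cons]; simp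
  have h := coeff_move (K := ZMod p) (p := p) (by simp) (List.replicate k z)
    (step b) (step d) [] v
  rw [wordSeries, mul_one, List.reverse_replicate, List.length_replicate,
    coeff_prime_step_mul hp, mul_assoc] at h
  · -- The series of the letter `step d` has no constant term, so that only the coefficients below
    -- degree `p` of the product of the two other series matter.
    have h2 : coeff p (letterSeries (ZMod p) (step d) *
          (wordSeries (ZMod p) (List.replicate k z ++ [step b]) * wordSeries (ZMod p) v))
        = coeff p (letterSeries (ZMod p) (step d) *
          ((shuffle (List.replicate k z ++ [step b]) v).map (wordSeries (ZMod p))).sum) := by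
      rw [coeff_mul, coeff_mul]
      refine Finset.sum_congr rfl ?_
      rintro ⟨i, j⟩ hij
      have hij := Finset.HasAntidiagonal.mem_antidiagonal.1 hij
      rcases Nat.eq_zero_or_pos i with rfl | hi
      · simp [coeff_letterSeries_step]
      · rw [coeff_wordSeries_mul (N := p) (fun n => natCast_ne_zero_of_lt)
          (admissible_replicate_append k b (v := []) trivial) hv (by simp only at hij; omega)]
    rw [h, h2, coeff_mul_sum_wordSeries hp]
    · ring
    · intro x hx
      rw [oddWord_step_cons, oddWord_of_mem_shuffle hx, oddWord_append, oddWord_replicate_z,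
        oddWord_step_cons]
      simpa [oddWord] using hdb
  · rw [oddWord_step_cons, oddWord_append, oddWord_replicate_z, oddWord_step_cons, ← hdb]
    cases d <;> cases b <;> cases oddWord v <;> rfl

theorem combA_shuffleRel (k : ℕ) (b : Bool) {v : Word} (hv : Admissible v) :
    combA (shuffleRel k b v) = 0 := by
  rw [shuffleRel, combA, combA_map _ (fun x => x), wordA, intCast_mul_mk, ← map_add,
    ← map_zero mk]
  refine mk_eq_mk_of_ne_two fun p hp => ?_
  have := wordSum_shuffle hp k b hv
  simpa using this

/-! ### Stuffle product -/

/-- The data `(s₁ - 1, n₁ mod 2), …, (s_d - 1, n_d mod 2)` of a sum over `n₁ > ⋯ > n_d > 0` with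
exponents `sⱼ ≥ 1` and prescribed parities (`true` for odd). -/
abbrev Index := List (ℕ × Bool)

section Stuffle

variable {K : Type*} [Field K]

/-- The summand `[n ≡ q] / n ^ (s + 1)`, with the value `0` for `n = 0`. -/
noncomputable def term (s : ℕ) (q : Bool) (n : ℕ) : K :=
  if n.bodd = q then 1 / (n : K) ^ (s + 1) else 0

variable (K)

/-- The sum over `N > n₁ > ⋯ > n_d > 0` with the given exponents and parities. -/
noncomputable def indexSum : Index → ℕ → K
  | [], _ => 1
  | (s, q) :: t, N => ∑ n ∈ Finset.range N, term s q n * indexSum t n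

variable {K}

/-- The quasi-shuffles of `(s, q) :: u` with an index, given the function `F` that quasi-shuffles
`u` with it. -/
def stuffleAux (s : ℕ) (q : Bool) (u : Index) (F : Index → List Index) : Index → List Index
  | [] => [(s, q) :: u]
  | (s', q') :: v => (F ((s', q') :: v)).map ((s, q) :: ·) ++
      (stuffleAux s q u F v).map ((s', q') :: ·) ++
      match q == q' with
      | true => (F v).map ((s + s' + 1, q) :: ·)
      | false => []

/-- The list of all quasi-shuffles of two indices; two entries merge only if they have the same
parity. -/
def stuffle : Index → Index → List Index
  | [], v => [v]
  | (s, q) :: u, v => stuffleAux s q u (stuffle u) v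

theorem stuffle_cons_cons (s s' : ℕ) (q q' : Bool) (u v : Index) :
    stuffle ((s, q) :: u) ((s', q') :: v) = (stuffle u ((s', q') :: v)).map ((s, q) :: ·) ++
      (stuffle ((s, q) :: u) v).map ((s', q') :: ·) ++
      if q = q' then (stuffle u v).map ((s + s' + 1, q) :: ·) else [] := by
  cases q <;> cases q' <;> rfl

theorem sum_indexSum_map_cons (s : ℕ) (q : Bool) (l : List Index) (N : ℕ) :
    ((l.map ((s, q) :: ·)).map fun x => indexSum K x N).sum
      = ∑ n ∈ Finset.range N, term s q n * (l.map fun x => indexSum K x n).sum := by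
  induction l with
  | nil => simp
  | cons x l ih =>
    simp only [List.map_cons, List.sum_cons, ih, indexSum, mul_add, Finset.sum_add_distrib]

/-- The quasi-shuffle product formula, for sums truncated at any `N`. -/
theorem indexSum_mul (u v : Index) (N : ℕ) :
    indexSum K u N * indexSum K v N = ((stuffle u v).map fun x => indexSum K x N).sum := by
  induction u generalizing v N with
  | nil => simp [stuffle, indexSum]
  | cons a u ihu =>
    obtain ⟨s, q⟩ := a
    induction v generalizing N with
    | nil => simp [stuffle, stuffleAux, indexSum]
    | cons b v ihv =>
      obtain ⟨s', q'⟩ := b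
      have hm : ∀ n : ℕ, term s q n * term s' q' n * (indexSum K u n * indexSum K v n)
          = if q = q' then term (s + s' + 1) q n * ((stuffle u v).map fun x => indexSum K x n).sum
            else 0 := by
        intro n
        rw [ihu]
        unfold term
        split_ifs <;> simp_all
        left
        ring
      rw [stuffle_cons_cons, List.map_append, List.map_append, List.sum_append, List.sum_append,
        sum_indexSum_map_cons, sum_indexSum_map_cons]
      have hd : ((if q = q' then (stuffle u v).map ((s + s' + 1, q) :: ·) else []).map
            fun x => indexSum K x N).sum
          = ∑ n ∈ Finset.range N,
              term s q n * term s' q' n * (indexSum K u n * indexSum K v n) := by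
        simp_rw [hm]
        split_ifs
        · rw [sum_indexSum_map_cons]
        · simp
      rw [hd]
      clear hd
      simp_rw [← ihu, ← ihv]
      induction N with
      | zero => simp [indexSum]
      | succ N ih =>
        have h1 : ∀ (s : ℕ) (q : Bool) (t : Index),
            indexSum K ((s, q) :: t) (N + 1)
              = indexSum K ((s, q) :: t) N + term s q N * indexSum K t N :=
          fun s q t => Finset.sum_range_succ _ _
        rw [h1, h1, Finset.sum_range_succ, Finset.sum_range_succ, Finset.sum_range_succ]
        linear_combination ih

/-- The parity of the outermost summation variable. -/
def headParity : Index → Bool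
  | [] => false
  | (_, q) :: _ => q

/-- The word of an index, with the parities of the indices replaced by those of their
differences. -/
def toWord : Index → Word
  | [] => []
  | (s, q) :: t => List.replicate s z ++ step (q ^^ headParity t) :: toWord t

theorem oddWord_toWord (l : Index) : oddWord (toWord l) = headParity l := by
  induction l with
  | nil => rfl
  | cons a t ih =>
    rw [toWord, oddWord_append, oddWord_replicate_z, oddWord_step_cons, ih]
    simp [headParity]

theorem admissible_toWord (l : Index) : Admissible (toWord l) := by
  induction l with
  | nil => trivial
  | cons a t ih => exact admissible_replicate_append _ _ ih

theorem coeff_wordSeries_replicate (s : ℕ) (w : Word) (n : ℕ) :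
    coeff n (wordSeries K (List.replicate s z ++ w)) = coeff n (wordSeries K w) / (n : K) ^ s := by
  induction s with
  | zero => simp
  | succ s ih =>
    rw [List.replicate_succ, List.cons_append, wordSeries, coeff_logIntegral, letterSeries,
      one_mul, ih, pow_succ, div_div]

/-- The two encodings agree.  For `N = 0` they differ on the empty index. -/
theorem sum_coeff_wordSeries_toWord (l : Index) (N : ℕ) (hN : N ≠ 0) :
    ∑ n ∈ Finset.range N, coeff n (wordSeries K (toWord l)) = indexSum K l N := by
  induction l generalizing N with
  | nil =>
    simp only [toWord, wordSeries, indexSum, coeff_one]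
    rw [Finset.sum_ite_eq' (Finset.range N) 0, if_pos (Finset.mem_range.2 (Nat.pos_of_ne_zero hN))]
  | cons a t ih =>
    obtain ⟨s, q⟩ := a
    rw [indexSum]
    refine Finset.sum_congr rfl fun n _ => ?_
    rw [toWord, coeff_wordSeries_replicate, wordSeries, coeff_logIntegral,
      coeff_step_mul_wordSeries, oddWord_toWord]
    rcases Nat.eq_zero_or_pos n with rfl | hn
    · simp [term]
    · rw [ih n hn.ne', term]
      simp only [Bool.xor_assoc, Bool.xor_self, Bool.xor_false]
      split_ifs
      · rw [div_div, one_div_mul_eq_div, pow_succ']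
      · simp

end Stuffle

theorem wordSum_toWord (p : Nat.Primes) (l : Index) :
    wordSum p (toWord l) = indexSum (ZMod p) l p :=
  sum_coeff_wordSeries_toWord l p p.2.ne_zero

theorem wordA_toWord (l : Index) : wordA (toWord l) = mk fun p => indexSum (ZMod p) l p := by
  simp only [wordA, wordSum_toWord]

/-- The integer `c` times the product of the sums of two indices. -/
def stuffleComb (u v : Index) (c : ℤ) : Comb := (stuffle u v).map fun x => (toWord x, c)

theorem combA_stuffleComb (u v : Index) (c : ℤ) :
    combA (stuffleComb u v c) = (c : 𝒜) * (wordA (toWord u) * wordA (toWord v)) := by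
  rw [stuffleComb, combA_map, wordA_toWord, wordA_toWord, ← map_mul, intCast_mul_mk]
  congr 1
  funext p
  simp only [wordSum_toWord, Pi.mul_apply, indexSum_mul]

open Letter

/-! ### Relations and elimination -/

theorem mk_eq_mk_of_lt (k : ℕ) {f g : ∀ p : Nat.Primes, ZMod p}
    (h : ∀ p : Nat.Primes, k < p → f p = g p) : mk f = mk g := by
  refine mk_eq_mk_of_finite (((Set.finite_Iic k).preimage
    (f := fun p : Nat.Primes => (p : ℕ)) Subtype.coe_injective.injOn).subset fun p hp => ?_)
  by_contra hk
  exact hp (h p (not_le.1 hk))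

theorem eq_zero_of_natCast_mul {n : ℕ} (hn : n ≠ 0) {x : 𝒜} (h : (n : 𝒜) * x = 0) : x = 0 := by
  have h1 : algebraMap ℚ 𝒜 (n : ℚ)⁻¹ * (n : 𝒜) = 1 := by
    rw [← map_natCast (algebraMap ℚ 𝒜), ← map_mul, inv_mul_cancel₀ (Nat.cast_ne_zero.2 hn),
      map_one]
  rw [← one_mul x, ← h1, mul_assoc, h, mul_zero]

/-- Fermat's little theorem turns negative powers into positive ones. -/
theorem pow_eq_one_div_pow {p : Nat.Primes} {k : ℕ} (hk : k < (p : ℕ) - 1) (hk0 : k ≠ 0)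
    (x : ZMod p) : x ^ ((p : ℕ) - 1 - k) = 1 / x ^ k := by
  rcases eq_or_ne x 0 with rfl | hx
  · rw [zero_pow (by omega), zero_pow hk0, div_zero]
  · rw [eq_div_iff (pow_ne_zero k hx), ← pow_add, Nat.sub_add_cancel hk.le,
      ZMod.pow_card_sub_one_eq_one hx]

theorem sum_range_one_div_sq {p : Nat.Primes} (hp : 3 < (p : ℕ)) :
    ∑ n ∈ Finset.range p, 1 / (n : ZMod p) ^ 2 = 0 := by
  have h := FiniteField.sum_pow_lt_card_sub_one (ZMod p) ((p : ℕ) - 1 - 2) (by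
    rw [ZMod.card]; omega)
  simp only [pow_eq_one_div_pow (p := p) (k := 2) (by omega) two_ne_zero] at h
  rw [← h]
  refine Finset.sum_bij' (fun n _ => (n : ZMod p)) (fun x _ => x.val) ?_ ?_ ?_ ?_ ?_
  · simp
  · intro x _
    exact Finset.mem_range.2 (ZMod.val_lt x)
  · intro n hn
    exact ZMod.val_natCast_of_lt (Finset.mem_range.1 hn)
  · simp
  · simp

/-- Reversal identifies the sums of `1 / n ^ 2` over even and over odd `n`, which add up to zero. -/
theorem wordA_ze : wordA [z, e] = 0 := by
  have h1 : wordA [z, e] = (-1) ^ 2 * wordA [z, o] :=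
    wordA_dual (w := [z, e]) (by simp [dual, oddWord, step])
  have h2 : wordA [z, e] + wordA [z, o] = 0 := by
    rw [show wordA [z, e] = _ from wordA_toWord [(1, false)],
      show wordA [z, o] = _ from wordA_toWord [(1, true)], ← map_add, ← map_zero mk]
    refine mk_eq_mk_of_lt 3 fun p hp => ?_
    simp only [Pi.add_apply, Pi.zero_apply, indexSum, mul_one]
    rw [← Finset.sum_add_distrib, ← sum_range_one_div_sq hp]
    refine Finset.sum_congr rfl fun n _ => ?_
    cases hn : n.bodd <;> simp [term, hn]
  refine eq_zero_of_natCast_mul two_ne_zero ?_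
  rw [Nat.cast_two]
  linear_combination h1 + h2

/-- The shuffle relation for `o` and `o` says that `3 o o` vanishes. -/
theorem wordA_oo : wordA [o, o] = 0 := by
  have h := combA_shuffleRel 0 true (v := [o]) ⟨by simp, trivial⟩
  change ((1 : ℤ) : 𝒜) * wordA [o, o] +
    (((-1) ^ 0 : ℤ) * wordA [o, o] + (((-1) ^ 0 : ℤ) * wordA [o, o] + 0)) = 0 at h
  refine eq_zero_of_natCast_mul three_ne_zero ?_
  rw [← h]
  push_cast
  ring

theorem wordA_oe : wordA [o, e] = -2 * wordA [e, e] := by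
  have h1 : wordA [e, o] = (-1) ^ 2 * wordA [e, e] :=
    wordA_dual (w := [e, o]) (by simp [dual, oddWord, step])
  have h2 := combA_shuffleRel 0 true (v := [e]) ⟨by simp, trivial⟩
  change ((1 : ℤ) : 𝒜) * wordA [e, e] +
    (((-1) ^ 0 : ℤ) * wordA [o, e] + (((-1) ^ 0 : ℤ) * wordA [e, o] + 0)) = 0 at h2
  push_cast at h2
  linear_combination h2 - h1

/-- Raise the first exponent of an index. -/
def bump : Index → List Index
  | [] => []
  | (s, q) :: t => [(s + 1, q) :: t]

/-- All indices of a given weight. -/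
def indices : ℕ → List Index
  | 0 => [[]]
  | n + 1 => (indices n).flatMap fun l => ((0, false) :: l) :: ((0, true) :: l) :: bump l

/-- A list of relations of weight `w`: the shuffle relations with the words `z ^ k a`, and the
products of three relations of weight two with all sums of weight `w - 2`.  (For `w < 2` the latter
are still relations, but not of weight `w`.) -/
def relations (w : ℕ) : List Comb :=
  ((List.range w).flatMap fun k => (indices (w - 1 - k)).flatMap fun v =>
    [shuffleRel k false (toWord v), shuffleRel k true (toWord v)]) ++
  (indices (w - 2)).map (fun v => stuffleComb [(1, false)] v 1) ++
  (indices (w - 2)).map (fun v => stuffleComb [(0, false), (0, true)] v 1) ++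
  (indices (w - 2)).map fun v =>
    stuffleComb [(0, true), (0, false)] v 1 ++ stuffleComb [(0, false), (0, false)] v 2

theorem combA_of_mem_relations {w : ℕ} {l : Comb} (h : l ∈ relations w) : combA l = 0 := by
  simp only [relations, List.mem_append, List.mem_flatMap, List.mem_map, List.mem_cons,
    List.not_mem_nil, or_false] at h
  rcases h with ((⟨k, -, v, -, rfl | rfl⟩ | ⟨v, -, rfl⟩) | ⟨v, -, rfl⟩) | ⟨v, -, rfl⟩
  · exact combA_shuffleRel _ _ (admissible_toWord v)
  · exact combA_shuffleRel _ _ (admissible_toWord v)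
  · rw [combA_stuffleComb, show toWord [(1, false)] = [z, e] from rfl, wordA_ze]; simp
  · rw [combA_stuffleComb, show toWord [(0, false), (0, true)] = [o, o] from rfl, wordA_oo]
    simp
  · rw [combA_append, combA_stuffleComb, combA_stuffleComb,
      show toWord [(0, true), (0, false)] = [o, e] from rfl,
      show toWord [(0, false), (0, false)] = [e, e] from rfl, wordA_oe]
    push_cast
    ring

/-- The digit of a letter. -/
def Letter.code : Letter → ℕ | o => 1 | e => 2 | z => 3

/-- The number of letters other than `e`. -/
def countNonE : Word → ℕ
  | [] => 0
  | e :: w => countNonE w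
  | _ :: w => countNonE w + 1

/-- The digits of a word in base four, preceded by those of `n`. -/
def digits (n : ℕ) (w : Word) : ℕ := w.foldl (fun n l => 4 * n + l.code) n

/-- The coordinate of a word.  Words of the same length are ordered by the number of letters other
than `e`, then lexicographically; this order keeps the elimination sparse. -/
def encode (w : Word) : ℕ := digits (4 * countNonE w) w

theorem digits_append_singleton (n : ℕ) (w : Word) (a : Letter) :
    digits n (w ++ [a]) = 4 * digits n w + a.code := by
  simp [digits]

theorem eq_of_digits_eq {m n : ℕ} {u v : Word} (h : digits (4 * m) u = digits (4 * n) v) :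
    u = v := by
  induction u using List.reverseRecOn generalizing v with
  | nil =>
    rcases List.eq_nil_or_concat v with rfl | ⟨v, b, rfl⟩
    · rfl
    · rw [List.concat_eq_append, digits_append_singleton,
        show digits (4 * m) [] = 4 * m from rfl] at h
      cases b <;> simp only [Letter.code] at h <;> omega
  | append_singleton u a ih =>
    rcases List.eq_nil_or_concat v with rfl | ⟨v, b, rfl⟩
    · rw [digits_append_singleton, show digits (4 * n) [] = 4 * n from rfl] at h
      cases a <;> simp only [Letter.code] at h <;> omega
    · rw [List.concat_eq_append] at h ⊢
      rw [digits_append_singleton, digits_append_singleton] at h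
      obtain rfl : a = b := by
        cases a <;> cases b <;> first | rfl | (simp only [Letter.code] at h; omega)
      rw [ih (v := v) (by omega)]

theorem encode_injective : Function.Injective encode := fun _ _ h => eq_of_digits_eq h

/-- The coordinate and the coefficient of `c` times a word, modulo the reversal relations: of a
word and its dual, the one with the smaller code is used. -/
def wordTerm (w : Word) (c : ℤ) : ℕ × ℤ :=
  match Nat.ble (encode w) (encode (dual w)) with
  | true => (encode w, c)
  | false => (encode (dual w), (-1) ^ w.length * c)

/-- The row of a formal combination of words, modulo the reversal relations. -/
def toRow (l : Comb) : Row :=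
  l.foldr (fun x r => addTerm (wordTerm x.1 x.2).1 (wordTerm x.1 x.2).2 r) []

/-- The value in `𝒜` of a coordinate; a number that encodes no word has a junk value. -/
noncomputable def codeA (k : ℕ) : 𝒜 := wordA (Function.invFun encode k)

theorem codeA_encode (w : Word) : codeA (encode w) = wordA w := by
  rw [codeA, Function.leftInverse_invFun encode_injective]

/-- There is a second action of `ℚ` on `𝒜`, inherited from the rational multiples that every field
has.  The statement is about the action of the algebra structure, which is the one of submodules. -/
theorem intCast_smul (c : ℤ) {x : 𝒜} :
    HSMul.hSMul (self := @instHSMul ℚ 𝒜 Algebra.toSMul) (c : ℚ) x = (c : 𝒜) * x := by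
  rw [Algebra.smul_def, map_intCast]

theorem wordTerm_eq (w : Word) (c : ℤ) :
    ((wordTerm w c).2 : 𝒜) * codeA (wordTerm w c).1 = (c : 𝒜) * wordA w := by
  rw [wordTerm]
  split
  · rw [codeA_encode]
  · rename_i h
    have hd : dual w ≠ w := by
      intro hd
      rw [hd, Nat.ble_eq_true_of_le le_rfl] at h
      exact absurd h (by simp)
    rw [codeA_encode, wordA_dual hd]
    push_cast
    ring

theorem rowEval_toRow (l : Comb) : rowEval codeA (toRow l) = combA l := by
  induction l with
  | nil => rfl
  | cons x l ih =>
    obtain ⟨w, c⟩ := x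
    have h : toRow ((w, c) :: l) = addTerm (wordTerm w c).1 (wordTerm w c).2 (toRow l) := rfl
    rw [h, rowEval_addTerm, ih, combA, ← wordTerm_eq]
    congr 1
    exact intCast_smul _

/-- The members of a list at the positions of the binary digits `1` of `m`. -/
def select {α : Type*} : ℕ → List α → List α
  | _, [] => []
  | m, x :: l => match m % 2 with
    | 0 => select (m / 2) l
    | _ => x :: select (m / 2) l

theorem mem_of_mem_select {α : Type*} {m : ℕ} {l : List α} {x : α} (h : x ∈ select m l) :
    x ∈ l := by
  induction l generalizing m with
  | nil => exact h
  | cons y l ih =>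
    rw [select] at h
    split at h
    · exact List.mem_cons_of_mem _ (ih h)
    · rcases List.mem_cons.1 h with rfl | h
      · exact List.mem_cons_self
      · exact List.mem_cons_of_mem _ (ih h)

/-- Insert a row into a list of rows sorted by decreasing first coordinate. -/
def insertSorted (s : Row) : List Row → List Row
  | [] => [s]
  | r :: l => match s, r with
    | [], _ => r :: l
    | _, [] => s :: l
    | (k, _) :: _, (k', _) :: _ => match Nat.ble k' k with
      | true => s :: r :: l
      | false => r :: insertSorted s l

theorem mem_of_mem_insertSorted {s x : Row} {l : List Row} (h : x ∈ insertSorted s l) :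
    x = s ∨ x ∈ l := by
  induction l with
  | nil => simpa [insertSorted] using h
  | cons r l ih =>
    rcases s with _ | ⟨⟨k, c⟩, s⟩
    · rw [insertSorted] at h
      exact Or.inr h
    rcases r with _ | ⟨⟨k', c'⟩, r⟩
    · rw [insertSorted] at h
      · rcases List.mem_cons.1 h with h | h
        · exact Or.inl h
        · exact Or.inr (List.mem_cons_of_mem _ h)
      · simp
    · rw [insertSorted] at h
      split at h
      · exact List.mem_cons.1 h
      · rcases List.mem_cons.1 h with h | h
        · exact Or.inr (h ▸ List.mem_cons_self)
        · exact (ih h).imp_right (List.mem_cons_of_mem _)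

/-- Sort rows by decreasing first coordinate. -/
def sortRows (l : List Row) : List Row := l.foldr insertSorted []

theorem mem_of_mem_sortRows {x : Row} {l : List Row} (h : x ∈ sortRows l) : x ∈ l := by
  induction l with
  | nil => exact h
  | cons r l ih =>
    rcases mem_of_mem_insertSorted h with rfl | h
    · exact List.mem_cons_self
    · exact List.mem_cons_of_mem _ (ih h)

/-- An echelon form of the relations of weight `w` that the binary digits of `m` select.  The rows
with large first coordinates come first, which makes the insertions cheap. -/
def echelon (w m : ℕ) : List Row :=
  (sortRows ((select m (relations w)).map toRow)).foldl (fun B s => insertRow s B) []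

theorem rowEval_of_mem_echelon {M : Submodule ℚ 𝒜} (w m : ℕ) :
    ∀ r ∈ echelon w m, rowEval codeA r ∈ M := by
  refine foldl_insertRow_mem codeA M (by simp) fun r hr => ?_
  obtain ⟨c, hc, rfl⟩ := List.mem_map.1 (mem_of_mem_sortRows hr)
  rw [rowEval_toRow, combA_of_mem_relations (mem_of_mem_select hc)]
  exact M.zero_mem

/-- Whether the combinations `l'` reduce to zero modulo the selected relations and `l`. -/
def spanned (w m : ℕ) (l l' : List Comb) : Bool :=
  l'.all fun c =>
    reducesToZero (toRow c) ((l.map toRow).foldl (fun B s => insertRow s B) (echelon w m))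

/-- The rows of the relations evaluate to zero, hence lie in the span of the values of `l`, and so
does every row that reduces to zero. -/
theorem combA_mem_of_spanned {w m : ℕ} {l l' : List Comb} (h : spanned w m l l' = true)
    {c : Comb} (hc : c ∈ l') : combA c ∈ Submodule.span ℚ {x | x ∈ l.map combA} := by
  rw [spanned, List.all_eq_true] at h
  rw [← rowEval_toRow]
  refine rowEval_mem_of_reducesToZero codeA _
    (foldl_insertRow_mem codeA _ (rowEval_of_mem_echelon w m) fun r hr => ?_) (h c hc)
  obtain ⟨x, hx, rfl⟩ := List.mem_map.1 hr
  rw [rowEval_toRow]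
  exact Submodule.subset_span (List.mem_map_of_mem hx)

/-! ### Finite multiple `T`-values and finite Euler sums as combinations of words -/

/-- The index of a finite multiple `T`-value. -/
def tIndex : List ℕ → Index
  | [] => []
  | s :: t => (s - 1, (t.length + 1).bodd) :: tIndex t

theorem sum_Ico_eq_sum_range {K : Type*} [Field K] (f : ℕ → K) (hf : f 0 = 0) (N : ℕ) :
    ∑ n ∈ Finset.Ico 1 N, f n = ∑ n ∈ Finset.range N, f n := by
  rcases N with _ | N
  · simp
  · rw [Finset.range_eq_Ico, Finset.sum_eq_sum_Ico_succ_bot (Nat.succ_pos N), hf, zero_add]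

theorem bodd_eq_iff_modEq (m n : ℕ) : m.bodd = n.bodd ↔ m ≡ n [MOD 2] := by
  rw [Nat.ModEq, Nat.mod_two_of_bodd, Nat.mod_two_of_bodd]
  cases m.bodd <;> cases n.bodd <;> simp

theorem tSum_eq (p : Nat.Primes) (s : List ℕ) (hs : ∀ a ∈ s, 1 ≤ a) (N : ℕ) :
    tSum p s N = indexSum (ZMod p) (tIndex s) N := by
  induction s generalizing N with
  | nil => rfl
  | cons a t ih =>
    have ha := hs a (by simp)
    rw [tSum, tIndex, indexSum, Finset.sum_filter, sum_Ico_eq_sum_range]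
    · refine Finset.sum_congr rfl fun n _ => ?_
      rw [ih (fun x hx => hs x (by simp [hx])), term, Nat.sub_add_cancel ha]
      simp only [bodd_eq_iff_modEq]
      split_ifs <;> simp
    · simp [zero_pow (by omega : a ≠ 0)]

/-- The word of a finite multiple `T`-value, as a formal combination. -/
def tComb (s : List ℕ) : Comb := [(toWord (tIndex s), 1)]

theorem combA_tComb {s : List ℕ} (hs : ∀ a ∈ s, 1 ≤ a) : combA (tComb s) = tA s := by
  rw [tComb, combA, combA, wordA_toWord, tA]
  simp only [tSum_eq _ s hs]
  simp

/-- The expansion of a finite Euler sum over the parities of the summation variables. -/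
def eulerExpansion : List (ℕ × ℤˣ) → List (Index × ℤ)
  | [] => [([], 1)]
  | (s, σ) :: t => (eulerExpansion t).flatMap fun x =>
      [((s - 1, false) :: x.1, x.2), ((s - 1, true) :: x.1, σ * x.2)]

theorem eulerSum_eq (p : Nat.Primes) (s : List (ℕ × ℤˣ)) (hs : ∀ a ∈ s, 1 ≤ a.1) (N : ℕ) :
    eulerSum p s N
      = ((eulerExpansion s).map fun x => (x.2 : ZMod p) * indexSum (ZMod p) x.1 N).sum := by
  induction s generalizing N with
  | nil => simp [eulerSum, eulerExpansion, indexSum]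
  | cons a t ih =>
    obtain ⟨s, σ⟩ := a
    have ha : 1 ≤ s := hs (s, σ) (by simp)
    rw [eulerSum, sum_Ico_eq_sum_range _ (by simp [zero_pow (by omega : s ≠ 0)]), eulerExpansion]
    simp only [ih fun x hx => hs x (by simp [hx])]
    generalize eulerExpansion t = l
    induction l with
    | nil => simp
    | cons x l ihl =>
      simp only [List.map_cons, List.sum_cons, mul_add, Finset.sum_add_distrib, ihl,
        List.flatMap_cons, List.map_append, List.sum_append, List.map_nil, List.sum_nil]
      congr 1
      rw [indexSum, indexSum, Finset.mul_sum, add_zero, Finset.mul_sum, ← Finset.sum_add_distrib]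
      refine Finset.sum_congr rfl fun n _ => ?_
      have hσ : (σ ^ n : ℤˣ) = if n.bodd = true then σ else 1 := by
        have h := Nat.mod_two_of_bodd n
        rw [← Nat.mod_add_div n 2, pow_add, pow_mul, Int.units_sq, one_pow, mul_one]
        cases hn : n.bodd <;> simp [hn] at h <;> simp [h]
      rw [hσ, term, term, Nat.sub_add_cancel ha]
      cases hn : n.bodd
      · simp; ring
      · simp; ring

/-- A finite Euler sum as a formal combination of words. -/
def eulerComb (s : List (ℕ × ℤˣ)) : Comb := (eulerExpansion s).map fun x => (toWord x.1, x.2)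

theorem combA_eulerComb {s : List (ℕ × ℤˣ)} (hs : ∀ a ∈ s, 1 ≤ a.1) :
    combA (eulerComb s) = eulerA s := by
  rw [eulerComb, eulerA]
  simp only [eulerSum_eq _ s hs]
  generalize eulerExpansion s = l
  induction l with
  | nil => exact (map_zero mk).symm
  | cons x l ih =>
    rw [List.map_cons, combA, ih, wordA_toWord, intCast_mul_mk, ← map_add]
    congr 1

/-- All compositions of `n`. -/
def compositions : ℕ → List (List ℕ)
  | 0 => [[]]
  | n + 1 => (compositions n).flatMap fun l => (1 :: l) :: match l with
    | [] => []
    | a :: t => [(a + 1) :: t]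

theorem mem_compositions_iff {n : ℕ} {s : List ℕ} :
    s ∈ compositions n ↔ (∀ a ∈ s, 1 ≤ a) ∧ s.sum = n := by
  induction n generalizing s with
  | zero =>
    rw [compositions, List.mem_singleton]
    constructor
    · rintro rfl; simp
    · rintro ⟨h1, h2⟩
      refine List.eq_nil_iff_forall_not_mem.2 fun a ha => ?_
      have := h1 a ha
      have := List.le_sum_of_mem ha
      omega
  | succ n ih =>
    rw [compositions, List.mem_flatMap]
    constructor
    · rintro ⟨l, hl, hs⟩
      obtain ⟨h1, h2⟩ := ih.1 hl
      rcases List.mem_cons.1 hs with rfl | hs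
      · refine ⟨by simpa using h1, by simp [h2, add_comm]⟩
      · rcases l with _ | ⟨a, t⟩
        · simp at hs
        · obtain rfl := List.mem_singleton.1 hs
          simp only [List.sum_cons, List.mem_cons, forall_eq_or_imp] at h1 h2 ⊢
          exact ⟨⟨by omega, h1.2⟩, by omega⟩
    · rintro ⟨h1, h2⟩
      rcases s with _ | ⟨a, t⟩
      · simp at h2
      · simp only [List.sum_cons, List.mem_cons, forall_eq_or_imp] at h1 h2
        rcases Nat.lt_or_ge 1 a with ha | ha
        · refine ⟨(a - 1) :: t, ih.2 ?_, ?_⟩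
          · simp only [List.sum_cons, List.mem_cons, forall_eq_or_imp]
            exact ⟨⟨by omega, h1.2⟩, by omega⟩
          · have : a - 1 + 1 = a := by omega
            simp [this]
        · obtain rfl : a = 1 := le_antisymm ha h1.1
          exact ⟨t, ih.2 ⟨h1.2, by omega⟩, by simp⟩

/-- The words of all finite multiple `T`-values of weight `w`. -/
def tCombs (w : ℕ) : List Comb := (compositions w).map tComb

theorem FMT_eq_span {w : ℕ} (hw : w ≠ 0) :
    FMT w = Submodule.span ℚ {x | x ∈ (tCombs w).map combA} := by
  rw [FMT]
  congr 1
  ext x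
  simp only [tCombs, Set.mem_ofPred_eq, List.mem_map]
  constructor
  · rintro ⟨s, -, h1, h2, rfl⟩
    exact ⟨_, ⟨s, mem_compositions_iff.2 ⟨h1, h2⟩, rfl⟩, combA_tComb h1⟩
  · rintro ⟨_, ⟨s, hs, rfl⟩, rfl⟩
    obtain ⟨h1, h2⟩ := mem_compositions_iff.1 hs
    refine ⟨s, ?_, h1, h2, (combA_tComb h1).symm⟩
    rintro rfl
    exact hw (by simpa using h2.symm)

theorem FMT_eq_of_spanned {w m : ℕ} (hw : w ≠ 0) {l : List Comb}
    (h : (spanned w m l (tCombs w) && spanned w m (tCombs w) l) = true) :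
    FMT w = Submodule.span ℚ {x | x ∈ l.map combA} := by
  rw [Bool.and_eq_true] at h
  rw [FMT_eq_span hw]
  refine le_antisymm (Submodule.span_le.2 ?_) (Submodule.span_le.2 ?_)
  · intro x hx
    obtain ⟨c, hc, rfl⟩ := List.mem_map.1 hx
    exact combA_mem_of_spanned h.1 hc
  · intro x hx
    obtain ⟨c, hc, rfl⟩ := List.mem_map.1 hx
    exact combA_mem_of_spanned h.2 hc

open Letter

/-! ### Bernoulli numbers and Fermat quotients -/

open PowerSeries in
/-- The value at `1/2` of the `n`-th Bernoulli polynomial is `(2 ^ (1 - n) - 1) B_n`; the leading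
summand `B_n` is left out on the left. -/
theorem sum_bernoulli_mul_half_pow (n : ℕ) :
    ∑ i ∈ Finset.range n, bernoulli i * (n.choose i : ℚ) * (1 / 2) ^ (n - i)
      = (2 * (1 / 2) ^ n - 2) * bernoulli n := by
  set G : ℚ⟦X⟧ := bernoulliPowerSeries ℚ with hG
  set E : ℚ⟦X⟧ := rescale (1 / 2 : ℚ) (exp ℚ) with hE
  have hGE : G * (exp ℚ - 1) = X := bernoulliPowerSeries_mul_exp_sub_one ℚ
  have hEE : E * E = exp ℚ := by
    rw [hE, exp_mul_exp_eq_exp_add]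
    norm_num [rescale_one]
  have hGE' : 2 * rescale (1 / 2 : ℚ) G * (E - 1) = X := by
    have h := congrArg (rescale (1 / 2 : ℚ)) hGE
    rw [map_mul, map_sub, map_one, rescale_X] at h
    rw [mul_assoc, h, ← mul_assoc, show (2 : ℚ⟦X⟧) = C (2 : ℚ) from (map_ofNat C 2).symm,
      ← map_mul]
    norm_num
  -- From `x / (e ^ x - 1) * e ^ (x / 2) = 2 (x / 2) / (e ^ (x / 2) - 1) - x / (e ^ x - 1)`.
  have key : G * E = 2 * rescale (1 / 2 : ℚ) G - G := by
    have hne : exp ℚ - 1 ≠ 0 := by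
      intro h
      rw [h, mul_zero] at hGE
      exact X_ne_zero hGE.symm
    refine mul_right_cancel₀ hne ?_
    rw [sub_mul, hGE, mul_right_comm, hGE, ← hEE]
    linear_combination (-(E + 1)) * hGE'
  have h : (n.factorial : ℚ) * coeff n (G * E)
      = n.factorial * coeff n (2 * rescale (1 / 2 : ℚ) G - G) := by rw [key]
  rw [coeff_mul, Finset.Nat.sum_antidiagonal_eq_sum_range_succ_mk, Finset.mul_sum, map_sub,
    show (2 : ℚ⟦X⟧) = C (2 : ℚ) from (map_ofNat C 2).symm, coeff_C_mul, hG, hE] at h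
  simp only [coeff_rescale, bernoulliPowerSeries, coeff_mk, coeff_exp, Algebra.algebraMap_self,
    RingHom.id_apply] at h
  have hn : (n.factorial : ℚ) ≠ 0 := Nat.cast_ne_zero.2 n.factorial_ne_zero
  have h2 : ∀ i ∈ Finset.range (n + 1), (n.factorial : ℚ) *
      (bernoulli i / i.factorial * ((1 / 2) ^ (n - i) * (1 / (n - i).factorial)))
      = bernoulli i * (n.choose i : ℚ) * (1 / 2) ^ (n - i) := by
    intro i hi
    rw [Nat.cast_choose ℚ (Finset.mem_range_succ_iff.1 hi)]
    ring
  rw [Finset.sum_congr rfl h2, Finset.sum_range_succ] at h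
  rw [Nat.choose_self, Nat.sub_self] at h
  have h3 : (n.factorial : ℚ) * (2 * ((1 / 2) ^ n * (bernoulli n / n.factorial))
      - bernoulli n / n.factorial) = (2 * (1 / 2) ^ n - 1) * bernoulli n := by
    field_simp
  rw [h3] at h
  push_cast at h
  linear_combination h

section Integral

variable {p : Nat.Primes}

/-- Rational numbers with denominator prime to `p`, on which the cast to `ℤ/pℤ` is additive and
multiplicative. -/
def IsIntegralAt (p : Nat.Primes) (x : ℚ) : Prop := (x.den : ZMod p) ≠ 0

theorem natCast_ne_zero_of_dvd {m n : ℕ} (h : m ∣ n) (hn : (n : ZMod p) ≠ 0) :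
    (m : ZMod p) ≠ 0 := by
  obtain ⟨k, rfl⟩ := h
  rw [Nat.cast_mul] at hn
  exact left_ne_zero_of_mul hn

theorem IsIntegralAt.add {x y : ℚ} (hx : IsIntegralAt p x) (hy : IsIntegralAt p y) :
    IsIntegralAt p (x + y) :=
  natCast_ne_zero_of_dvd (Rat.add_den_dvd x y) (by rw [Nat.cast_mul]; exact mul_ne_zero hx hy)

theorem IsIntegralAt.mul {x y : ℚ} (hx : IsIntegralAt p x) (hy : IsIntegralAt p y) :
    IsIntegralAt p (x * y) :=
  natCast_ne_zero_of_dvd (Rat.mul_den_dvd x y) (by rw [Nat.cast_mul]; exact mul_ne_zero hx hy)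

theorem isIntegralAt_intCast (n : ℤ) : IsIntegralAt p n := by simp [IsIntegralAt]

theorem isIntegralAt_natCast (n : ℕ) : IsIntegralAt p n := by simp [IsIntegralAt]

theorem isIntegralAt_inv_natCast {n : ℕ} (hn : (n : ZMod p) ≠ 0) :
    IsIntegralAt p (n : ℚ)⁻¹ := by
  rw [IsIntegralAt, Rat.inv_natCast_den]
  split_ifs
  · simp
  · exact hn

theorem IsIntegralAt.pow {x : ℚ} (hx : IsIntegralAt p x) (n : ℕ) : IsIntegralAt p (x ^ n) := by
  induction n with
  | zero => simp [IsIntegralAt]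
  | succ n ih => rw [pow_succ]; exact ih.mul hx

theorem IsIntegralAt.cast_pow {x : ℚ} (hx : IsIntegralAt p x) (n : ℕ) :
    ((x ^ n : ℚ) : ZMod p) = (x : ZMod p) ^ n := by
  induction n with
  | zero => simp
  | succ n ih => rw [pow_succ, Rat.cast_mul_of_ne_zero (hx.pow n) hx, ih, pow_succ]

theorem IsIntegralAt.sum {ι : Type*} {s : Finset ι} {f : ι → ℚ}
    (h : ∀ i ∈ s, IsIntegralAt p (f i)) : IsIntegralAt p (∑ i ∈ s, f i) := by
  classical
  induction s using Finset.induction_on with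
  | empty => simp [IsIntegralAt]
  | insert i s hi ih =>
    rw [Finset.sum_insert hi]
    exact (h i (by simp)).add (ih fun j hj => h j (by simp [hj]))

theorem cast_sum_of_isIntegralAt {ι : Type*} {s : Finset ι} {f : ι → ℚ}
    (h : ∀ i ∈ s, IsIntegralAt p (f i)) :
    ((∑ i ∈ s, f i : ℚ) : ZMod p) = ∑ i ∈ s, (f i : ZMod p) := by
  classical
  induction s using Finset.induction_on with
  | empty => simp
  | insert i s hi ih =>
    have hs : ∀ j ∈ s, IsIntegralAt p (f j) := fun j hj => h j (by simp [hj])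
    rw [Finset.sum_insert hi, Rat.cast_add_of_ne_zero (h i (by simp)) (IsIntegralAt.sum hs),
      ih hs, Finset.sum_insert hi]

/-- The Bernoulli numbers `B_n` with `n < p - 1` are integral at `p`, by their recursion. -/
theorem isIntegralAt_bernoulli {n : ℕ} (hn : n + 1 < p) : IsIntegralAt p (bernoulli n) := by
  have h' : ∀ n : ℕ, n + 1 < p → IsIntegralAt p (bernoulli' n) := by
    intro n
    induction n using Nat.strong_induction_on with
    | _ n ih =>
      intro hn
      rw [bernoulli'_def, sub_eq_add_neg, ← neg_one_mul]
      have h1 : IsIntegralAt p 1 := by simpa using isIntegralAt_natCast (p := p) 1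
      have h2 : IsIntegralAt p (-1) := by simpa using isIntegralAt_intCast (p := p) (-1)
      refine h1.add (h2.mul (IsIntegralAt.sum fun k hk => ?_))
      have hk := Finset.mem_range.1 hk
      refine IsIntegralAt.mul ?_ (ih k hk (by omega))
      rw [div_eq_mul_inv, show (n : ℚ) - k + 1 = ((n - k + 1 : ℕ) : ℚ) by
        push_cast [Nat.cast_sub hk.le]; ring]
      exact (isIntegralAt_natCast _).mul
        (isIntegralAt_inv_natCast (natCast_ne_zero_of_lt (by omega) (by omega)))
  rw [bernoulli]
  exact (by simpa using (isIntegralAt_intCast (p := p) (-1)).pow n :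
    IsIntegralAt p ((-1) ^ n)).mul (h' n hn)

/-- The power sum over `0 ≤ m < (p + 1) / 2`: Faulhaber's formula at `1/2` modulo `p`. -/
theorem sum_range_half_pow {k : ℕ} (hk : k + 2 < p) (hp : (p : ℕ) ≠ 2) :
    ((k + 1 : ℕ) : ZMod p) * ∑ m ∈ Finset.range (((p : ℕ) + 1) / 2), (m : ZMod p) ^ k
      = (2 * (1 / 2) ^ (k + 1) - 2) * (bernoulli (k + 1) : ℚ) := by
  have h2 : ((2 : ℕ) : ZMod p) ≠ 0 :=
    natCast_ne_zero_of_lt two_pos (lt_of_le_of_ne p.2.two_le (Ne.symm hp))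
  have h2' : (2 : ZMod p) ≠ 0 := by exact_mod_cast h2
  have hhalf : IsIntegralAt p (1 / 2) := by
    simpa using isIntegralAt_inv_natCast h2
  have hhalf_cast : (((1 / 2 : ℚ)) : ZMod p) = 1 / 2 := by
    have := Rat.cast_mul_of_ne_zero (α := ZMod p) (p := 1 / 2) (q := 2) hhalf (by simp)
    rw [show (1 / 2 * 2 : ℚ) = 1 by norm_num, Rat.cast_one, Rat.cast_ofNat] at this
    rw [eq_div_iff h2', this]
  set N := ((p : ℕ) + 1) / 2 with hN
  have hNhalf : (N : ZMod p) = 1 / 2 := by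
    rw [eq_div_iff h2']
    have hodd := p.2.eq_two_or_odd.resolve_left hp
    have : N * 2 = p + 1 := by omega
    have h := congrArg (Nat.cast (R := ZMod p)) this
    push_cast at h
    rw [h, ZMod.natCast_self, zero_add]
  have hB : ∀ i ∈ Finset.range (k + 1), IsIntegralAt p (bernoulli i) := fun i hi =>
    isIntegralAt_bernoulli (by have := Finset.mem_range.1 hi; omega)
  have hBc : ∀ x : ℚ, IsIntegralAt p x → ∀ i ∈ Finset.range (k + 1),
      IsIntegralAt p (bernoulli i * ((k + 1).choose i : ℚ) * x ^ (k + 1 - i)) ∧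
      ((bernoulli i * ((k + 1).choose i : ℚ) * x ^ (k + 1 - i) : ℚ) : ZMod p)
        = (bernoulli i : ZMod p) * ((k + 1).choose i : ZMod p) * (x : ZMod p) ^ (k + 1 - i) := by
    intro x hx i hi
    have h1 := (hB i hi).mul (isIntegralAt_natCast (p := p) ((k + 1).choose i))
    refine ⟨h1.mul (hx.pow _), ?_⟩
    rw [Rat.cast_mul_of_ne_zero h1 (hx.pow _), hx.cast_pow,
      Rat.cast_mul_of_ne_zero (hB i hi) (isIntegralAt_natCast _), Rat.cast_natCast]
  have hF : ((k + 1 : ℕ) : ℚ) * ((∑ m ∈ Finset.range N, m ^ k : ℕ) : ℚ)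
      = ∑ i ∈ Finset.range (k + 1),
        bernoulli i * ((k + 1).choose i : ℚ) * (N : ℚ) ^ (k + 1 - i) := by
    push_cast
    rw [sum_range_pow, Finset.mul_sum]
    refine Finset.sum_congr rfl fun i _ => ?_
    field_simp
  have hF' := congrArg (Rat.cast (K := ZMod p)) hF
  have hS := congrArg (Rat.cast (K := ZMod p)) (sum_bernoulli_mul_half_pow (k + 1))
  rw [cast_sum_of_isIntegralAt fun i hi => (hBc N (isIntegralAt_natCast N) i hi).1,
    Finset.sum_congr rfl fun i hi => (hBc N (isIntegralAt_natCast N) i hi).2, Rat.cast_natCast,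
    hNhalf, ← Nat.cast_mul, Rat.cast_natCast] at hF'
  rw [cast_sum_of_isIntegralAt fun i hi => (hBc _ hhalf i hi).1,
    Finset.sum_congr rfl fun i hi => (hBc _ hhalf i hi).2, hhalf_cast, ← hF'] at hS
  push_cast at hS ⊢
  rw [hS]
  have hc : IsIntegralAt p (2 * (1 / 2) ^ (k + 1)) := by
    have : IsIntegralAt p 2 := by simpa using isIntegralAt_natCast (p := p) 2
    exact this.mul (hhalf.pow _)
  have hc2 : IsIntegralAt p (-2) := by
    simpa using isIntegralAt_intCast (p := p) (-2)
  rw [sub_eq_add_neg, Rat.cast_mul_of_ne_zero (hc.add hc2)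
    (isIntegralAt_bernoulli (by omega)), Rat.cast_add_of_ne_zero hc hc2,
    Rat.cast_mul_of_ne_zero (by simp) (hhalf.pow _), hhalf.cast_pow, hhalf_cast]
  push_cast
  ring

/-- Depth one: for odd `w`, the sum of `1 / n ^ w` over the odd `n < p` is, up to the factor
`1 - 2 ^ (1 - w)`, equal to `B_{p - w} / w`.  Here `w = 2 r + 1`, and `w = 1` is excluded because
`B_{p - 1}` is not integral at `p`. -/
theorem wordSum_replicate_o {r : ℕ} (hr : r ≠ 0) (hp : 2 * r + 3 < (p : ℕ)) :
    (2 : ZMod p) ^ (2 * r) * wordSum p (List.replicate (2 * r) z ++ [o])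
      = (2 ^ (2 * r) - 1) * ((bernoulli ((p : ℕ) - (2 * r + 1)) : ℚ) / ((2 * r + 1 : ℕ) : ZMod p))
    := by
  have hp2 : (p : ℕ) ≠ 2 := by omega
  have h2 : (2 : ZMod p) ≠ 0 := by
    exact_mod_cast natCast_ne_zero_of_lt (p := p) two_pos (by omega)
  have hodd := p.2.eq_two_or_odd.resolve_left hp2
  -- By reversal, the sum over the even `n` is the opposite.
  have hdual : wordSum p (List.replicate (2 * r) z ++ [o])
      = -wordSum p (List.replicate (2 * r) z ++ [e]) := by
    have h := wordSum_dual hp2 (List.replicate (2 * r) z) true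
    rw [dual_append_step, oddWord_append, oddWord_replicate_z, List.reverse_replicate,
      List.length_replicate, Odd.neg_one_pow ⟨r, rfl⟩] at h
    simpa [step, oddWord] using h
  have heven : wordSum p (List.replicate (2 * r) z ++ [e])
      = ∑ m ∈ Finset.range (((p : ℕ) + 1) / 2), 1 / ((2 * m : ℕ) : ZMod p) ^ (2 * r + 1) := by
    rw [show List.replicate (2 * r) z ++ [e] = toWord [(2 * r, false)] from rfl, wordSum_toWord,
      indexSum]
    simp only [indexSum, mul_one, term]
    rw [← Finset.sum_filter]
    refine Finset.sum_bij' (fun n _ => n / 2) (fun m _ => 2 * m) ?_ ?_ ?_ ?_ ?_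
    · intro n hn
      have := Finset.mem_range.1 (Finset.mem_filter.1 hn).1
      exact Finset.mem_range.2 (by omega)
    · intro m hm
      have := Finset.mem_range.1 hm
      exact Finset.mem_filter.2 ⟨Finset.mem_range.2 (by omega), by simp [Nat.bodd_mul]⟩
    · intro n hn
      have h := Nat.mod_two_of_bodd n
      rw [(Finset.mem_filter.1 hn).2] at h
      simp only [Bool.toNat_false] at h
      omega
    · intro m _
      omega
    · intro n hn
      have h := Nat.mod_two_of_bodd n
      rw [(Finset.mem_filter.1 hn).2] at h
      simp only [Bool.toNat_false] at h
      rw [show 2 * (n / 2) = n by omega]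
  set k := (p : ℕ) - 1 - (2 * r + 1) with hk
  have hsum := sum_range_half_pow (p := p) (k := k) (by omega) hp2
  have hk1 : k + 1 = p - (2 * r + 1) := by omega
  have hcast : ((k + 1 : ℕ) : ZMod p) = -((2 * r + 1 : ℕ) : ZMod p) := by
    rw [eq_neg_iff_add_eq_zero, ← Nat.cast_add, hk1, Nat.sub_add_cancel (by omega),
      ZMod.natCast_self]
  have hw : ((2 * r + 1 : ℕ) : ZMod p) ≠ 0 := natCast_ne_zero_of_lt (by omega) (by omega)
  have hpow : (1 / 2 : ZMod p) ^ (k + 1) = 2 ^ (2 * r) := by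
    rw [one_div_pow, div_eq_iff (pow_ne_zero _ h2), ← pow_add,
      show 2 * r + (k + 1) = p - 1 by omega, ZMod.pow_card_sub_one_eq_one h2]
  have hterm : ∀ m ∈ Finset.range (((p : ℕ) + 1) / 2),
      1 / ((2 * m : ℕ) : ZMod p) ^ (2 * r + 1) = 1 / 2 ^ (2 * r + 1) * (m : ZMod p) ^ k := by
    intro m _
    rw [hk, pow_eq_one_div_pow (by omega) (by omega)]
    push_cast
    rw [mul_pow, one_div_mul_one_div]
  rw [Finset.sum_congr rfl hterm, ← Finset.mul_sum] at heven
  rw [hdual, heven, ← hk1]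
  rw [hcast, hpow] at hsum
  have h22 : (2 : ZMod p) ^ (2 * r) ≠ 0 := pow_ne_zero _ h2
  rw [mul_div_assoc', eq_div_iff hw, pow_succ]
  field_simp
  linear_combination hsum

end Integral

theorem wordA_replicate_o {r : ℕ} (hr : r ≠ 0) :
    (2 : 𝒜) ^ (2 * r) * wordA (List.replicate (2 * r) z ++ [o])
      = (2 ^ (2 * r) - 1) * β (2 * r + 1) := by
  rw [wordA, β, show (2 : 𝒜) = mk 2 from (map_ofNat mk 2).symm, ← map_pow, ← map_mul,
    ← map_one mk, ← map_sub, ← map_mul]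
  refine mk_eq_mk_of_lt (2 * r + 3) fun p hp => ?_
  have := wordSum_replicate_o hr hp
  simp only [Pi.mul_apply, Pi.sub_apply, Pi.pow_apply, Pi.ofNat_apply]
  rw [if_pos (by omega), this]

theorem natCast_choose_prime_sub_one {p : Nat.Primes} (k : ℕ) (hk : k < p) :
    ((((p : ℕ) - 1).choose k : ℕ) : ZMod p) = (-1) ^ k := by
  induction k with
  | zero => simp
  | succ k ih =>
    have h := Nat.choose_succ_succ ((p : ℕ) - 1) k
    rw [Nat.succ_eq_add_one, Nat.sub_add_cancel p.2.one_le] at h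
    have hp : (((p : ℕ).choose (k + 1) : ℕ) : ZMod p) = 0 :=
      (ZMod.natCast_eq_zero_iff _ _).2 (p.2.dvd_choose_self (by omega) hk)
    rw [h, Nat.cast_add, ih (by omega)] at hp
    rw [pow_succ]
    linear_combination hp

/-- Both sides are halves of `∑ (-1) ^ (n - 1) / n`, the reduction of `(2 ^ p - 2) / p`. -/
theorem q₂_eq_wordA : q₂ = wordA [o] := by
  rw [q₂, wordA]
  refine mk_eq_mk_of_ne_two fun p hp => ?_
  have hp3 : 3 ≤ (p : ℕ) := by have := p.2.two_le; omega
  have h2 : (2 : ZMod p) ≠ 0 := by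
    exact_mod_cast natCast_ne_zero_of_lt (p := p) two_pos (by omega)
  rw [if_pos hp3]
  have hdual : wordSum p [o] = -wordSum p [e] := by
    have h := wordSum_dual hp [] true
    simpa [dual_append_step, step, oddWord, dual] using h
  have hsplit : wordSum p [o] - wordSum p [e]
      = ∑ n ∈ Finset.Ico 1 (p : ℕ), (-1) ^ (n - 1) / (n : ZMod p) := by
    rw [show [o] = toWord [(0, true)] from rfl, show [e] = toWord [(0, false)] from rfl,
      wordSum_toWord, wordSum_toWord, indexSum, indexSum, ← Finset.sum_sub_distrib,
      ← sum_Ico_eq_sum_range _ (by simp [term])]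
    refine Finset.sum_congr rfl fun n hn => ?_
    have hn1 := (Finset.mem_Ico.1 hn).1
    obtain ⟨m, rfl⟩ := Nat.exists_eq_add_of_le' hn1
    have hm := Nat.mod_two_of_bodd m
    cases hb : m.bodd
    · have : Even m := Nat.even_iff.2 (by simp [hm, hb])
      simp [term, indexSum, hb, this.neg_one_pow]
    · have : Odd m := Nat.odd_iff.2 (by simp [hm, hb])
      simp [term, indexSum, hb, this.neg_one_pow, neg_div]
  -- The numbers `C(p, n) / p` are congruent to `(-1) ^ (n - 1) / n` and add up to
  -- `(2 ^ p - 2) / p`.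
  have hchoose : ∀ n ∈ Finset.Ico 1 (p : ℕ),
      (((p : ℕ).choose n / p : ℕ) : ZMod p) = (-1) ^ (n - 1) / (n : ZMod p) := by
    intro n hn
    obtain ⟨hn1, hn2⟩ := Finset.mem_Ico.1 hn
    obtain ⟨c, hc⟩ := p.2.dvd_choose_self (by omega) hn2
    rw [hc, Nat.mul_div_cancel_left _ p.2.pos, eq_div_iff (natCast_ne_zero_of_lt hn1 hn2),
      ← natCast_choose_prime_sub_one (n - 1) (by omega), ← Nat.cast_mul]
    congr 1
    have h := Nat.add_one_mul_choose_eq ((p : ℕ) - 1) (n - 1)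
    rw [Nat.sub_add_cancel p.2.one_le, Nat.sub_add_cancel hn1, hc, mul_assoc] at h
    exact (Nat.eq_of_mul_eq_mul_left p.2.pos h).symm
  have hfermat : (p : ℕ) ∣ 2 ^ ((p : ℕ) - 1) - 1 := by
    rw [← ZMod.natCast_eq_zero_iff, Nat.cast_sub Nat.one_le_two_pow]
    push_cast
    rw [ZMod.pow_card_sub_one_eq_one h2, sub_self]
  obtain ⟨c, hc⟩ := hfermat
  have hsum : ∑ n ∈ Finset.Ico 1 (p : ℕ), (p : ℕ).choose n / p = 2 * c := by
    refine Nat.eq_of_mul_eq_mul_left p.2.pos ?_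
    rw [Finset.mul_sum, Finset.sum_congr rfl fun n hn => Nat.mul_div_cancel'
      (p.2.dvd_choose_self (by have := Finset.mem_Ico.1 hn; omega) (Finset.mem_Ico.1 hn).2)]
    have h := Nat.sum_range_choose p
    rw [Finset.range_eq_Ico, Finset.sum_eq_sum_Ico_succ_bot (Nat.succ_pos _),
      Finset.sum_Ico_succ_top p.2.one_le, Nat.choose_zero_right, Nat.choose_self] at h
    have h2p : 2 ^ (p : ℕ) = 2 * 2 ^ ((p : ℕ) - 1) := by
      rw [← pow_succ', Nat.sub_add_cancel p.2.one_le]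
    have := Nat.one_le_two_pow (n := (p : ℕ) - 1)
    rw [mul_left_comm, ← hc]
    omega
  rw [hc, Nat.mul_div_cancel_left _ p.2.pos]
  refine mul_left_cancel₀ h2 ?_
  have h := congrArg (Nat.cast (R := ZMod p)) hsum
  push_cast at h
  have h' := Finset.sum_congr rfl hchoose
  rw [← h, h', ← hsplit, hdual]
  ring

open Letter

/-! ### Weights one to six -/

theorem span_insert_smul {c : ℚ} (hc : c ≠ 0) (x : 𝒜) (s : Set 𝒜) {y : 𝒜}
    (hy : algebraMap ℚ 𝒜 c * x = y) :
    Submodule.span ℚ (insert y s) = Submodule.span ℚ (insert x s) := by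
  rw [Submodule.span_insert, Submodule.span_insert, ← hy, ← Algebra.smul_def,
    Submodule.span_singleton_smul_eq (IsUnit.mk0 c hc)]

theorem wordA_zzo : algebraMap ℚ 𝒜 (3 / 4) * β 3 = wordA [z, z, o] := by
  have h : (2 : 𝒜) ^ 2 * wordA [z, z, o] = (2 ^ 2 - 1) * β 3 :=
    wordA_replicate_o (r := 1) one_ne_zero
  have h4 : algebraMap ℚ 𝒜 (1 / 4) * 4 = 1 := by
    rw [← map_ofNat (algebraMap ℚ 𝒜) 4, ← map_mul]; norm_num
  have h34 : algebraMap ℚ 𝒜 (3 / 4) = algebraMap ℚ 𝒜 (1 / 4) * 3 := by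
    rw [← map_ofNat (algebraMap ℚ 𝒜) 3, ← map_mul]; norm_num
  rw [h34]
  linear_combination (-algebraMap ℚ 𝒜 (1 / 4)) * h + wordA [z, z, o] * h4

theorem wordA_zzzzo : algebraMap ℚ 𝒜 (15 / 16) * β 5 = wordA [z, z, z, z, o] := by
  have h : (2 : 𝒜) ^ 4 * wordA [z, z, z, z, o] = (2 ^ 4 - 1) * β 5 :=
    wordA_replicate_o (r := 2) two_ne_zero
  have h4 : algebraMap ℚ 𝒜 (1 / 16) * 16 = 1 := by
    rw [← map_ofNat (algebraMap ℚ 𝒜) 16, ← map_mul]; norm_num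
  have h34 : algebraMap ℚ 𝒜 (15 / 16) = algebraMap ℚ 𝒜 (1 / 16) * 15 := by
    rw [← map_ofNat (algebraMap ℚ 𝒜) 15, ← map_mul]; norm_num
  rw [h34]
  linear_combination (-algebraMap ℚ 𝒜 (1 / 16)) * h + wordA [z, z, z, z, o] * h4

theorem combA_singleton (w : Word) : combA [(w, 1)] = wordA w := by simp [combA]

set_option maxRecDepth 100000

/-- In weights one to four all relations are used: the number `2 ^ 100 - 1` has more digits than
there are relations. -/
theorem FMT_one : FMT 1 = Submodule.span ℚ {q₂} := by
  have h := FMT_eq_of_spanned (w := 1) (m := 2 ^ 100 - 1) one_ne_zero (l := [[([o], 1)]])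
    (by decide +kernel)
  rw [h, q₂_eq_wordA]
  simp only [List.map_cons, List.map_nil, combA_singleton]
  congr 1
  ext x
  simp

theorem FMT_two : FMT 2 = ⊥ := by
  have h := FMT_eq_of_spanned (w := 2) (m := 2 ^ 100 - 1) two_ne_zero (l := [])
    (by decide +kernel)
  rw [h]
  simp

theorem FMT_three : FMT 3 = Submodule.span ℚ {β 3} := by
  have h := FMT_eq_of_spanned (w := 3) (m := 2 ^ 100 - 1) three_ne_zero
    (l := [[([z, z, o], 1)]]) (by decide +kernel)
  have h1 := span_insert_smul (c := 3 / 4) (by norm_num) (β 3) ∅ wordA_zzo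
  rw [insert_empty_eq, insert_empty_eq] at h1
  rw [h, ← h1]
  simp only [List.map_cons, List.map_nil, combA_singleton]
  congr 1
  ext x
  simp

theorem FMT_four :
    FMT 4 = Submodule.span ℚ {q₂ * β 3, eulerA [(1, 1), (3, -1)]} := by
  have h := FMT_eq_of_spanned (w := 4) (m := 2 ^ 100 - 1) four_ne_zero
    (l := [stuffleComb [(0, true)] [(2, true)] 1, eulerComb [(1, 1), (3, -1)]])
    (by decide +kernel)
  have h1 : combA (stuffleComb [(0, true)] [(2, true)] 1)
      = algebraMap ℚ 𝒜 (3 / 4) * (q₂ * β 3) := by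
    rw [combA_stuffleComb, show toWord [(0, true)] = [o] from rfl,
      show toWord [(2, true)] = [z, z, o] from rfl, ← wordA_zzo, q₂_eq_wordA]
    push_cast
    ring
  rw [h, ← span_insert_smul (by norm_num) _ _ h1.symm, ← combA_eulerComb (by simp)]
  congr 1
  ext x
  simp

/-- The digits of `m` mark a basis of the span of all relations of weight five; the other relations
would only be reduced to zero. -/
theorem FMT_five :
    FMT 5 = Submodule.span ℚ
      {β 5, eulerA [(1, -1), (2, 1), (2, 1)], eulerA [(1, -1), (2, -1), (2, 1)]} := by
  have h := FMT_eq_of_spanned (w := 5)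
    (m := 93288783826544581171712697173222872659490010691016321561069608637)
    (by norm_num)
    (l := [[([z, z, z, z, o], 1)], eulerComb [(1, -1), (2, 1), (2, 1)],
      eulerComb [(1, -1), (2, -1), (2, 1)]]) (by decide +kernel)
  rw [h, ← span_insert_smul (by norm_num) _ _ wordA_zzzzo, ← combA_eulerComb (by simp),
    ← combA_eulerComb (by simp), ← combA_singleton]
  congr 1
  ext x
  simp

/-- As in weight five, the digits of `m` mark a basis of the span of all relations. -/
theorem FMT_six :
    FMT 6 = Submodule.span ℚ
      {β 3 ^ 2, q₂ * β 5, eulerA [(1, -1), (2, 1), (1, 1), (2, 1)]} := by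
  have h := FMT_eq_of_spanned (w := 6)
    (m := 1074768963654526654612781298545225949435524880743115261363342679701182692039967384641440637926977692660654239758634794526314238628425319857881288364907685003824576739310166084391645732107351490493)
    (by norm_num)
    (l := [stuffleComb [(2, true)] [(2, true)] 1, stuffleComb [(0, true)] [(4, true)] 1,
      eulerComb [(1, -1), (2, 1), (1, 1), (2, 1)]]) (by decide +kernel)
  have h1 : combA (stuffleComb [(2, true)] [(2, true)] 1)
      = algebraMap ℚ 𝒜 (9 / 16) * β 3 ^ 2 := by
    rw [combA_stuffleComb, show toWord [(2, true)] = [z, z, o] from rfl, ← wordA_zzo,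
      show (9 / 16 : ℚ) = 3 / 4 * (3 / 4) by norm_num, map_mul]
    push_cast
    ring
  have h2 : combA (stuffleComb [(0, true)] [(4, true)] 1)
      = algebraMap ℚ 𝒜 (15 / 16) * (q₂ * β 5) := by
    rw [combA_stuffleComb, show toWord [(0, true)] = [o] from rfl,
      show toWord [(4, true)] = [z, z, z, z, o] from rfl, ← wordA_zzzzo, q₂_eq_wordA]
    push_cast
    ring
  rw [h, ← span_insert_smul (by norm_num) _ _ h1.symm, Set.insert_comm,
    ← span_insert_smul (by norm_num) _ _ h2.symm, ← combA_eulerComb (by simp), Set.insert_comm]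
  congr 1
  ext x
  simp

end FiniteMTV

open FiniteMTV in
theorem mainTheorem6 :
    FMT 1 = Submodule.span ℚ {q₂} ∧
    FMT 2 = ⊥ ∧
    FMT 3 = Submodule.span ℚ {β 3} ∧
    FMT 4 = Submodule.span ℚ {q₂ * β 3, eulerA [(1, 1), (3, -1)]} ∧
    FMT 5 = Submodule.span ℚ
      {β 5, eulerA [(1, -1), (2, 1), (2, 1)], eulerA [(1, -1), (2, -1), (2, 1)]} ∧
    FMT 6 = Submodule.span ℚ
      {β 3 ^ 2, q₂ * β 5, eulerA [(1, -1), (2, 1), (1, 1), (2, 1)]} :=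
  ⟨FMT_one, FMT_two, FMT_three, FMT_four, FMT_five, FMT_six⟩
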